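/- Let $\mathfrak g$ be a finite-dimensional complex semisimple Lie algebra with Cartan subalgebra $\mathfrak h$; more generally, all that is used is a (reduced, crystallographic) root system $\Phi\subset\mathfrak h^*$ spanning the finite-dimensional complex vector space $\mathfrak h^*$. Let $\Pi\subset\Phi$ be a base, $\Phi^+$ the positive roots, $W$ the Weyl group with length function $\ell$ with respect to the simple reflections $s_\alpha$ ($\alpha\in\Pi$), and $w_0$ its longest element. Let $R=S(\mathfrak h^*)$, graded with $\mathfrak h^*$ in degree $2$, let $I_W\subset R$ be the ideal generated by the homogeneous $W$-invariants of positive degree, and let $C=R/I_W$ be the coinvariant algebra. For $\alpha\in\Pi$ let $\Delta_{s_\alpha}(f)=(f-s_\alpha f)/\alpha$ on $R$, and let $\Delta_w=\Delta_{s_{j_1}}\cdots\Delta_{s_{j_k}}$ for a reduced expression $w=s_{j_1}\cdots s_{j_k}$ (this does not depend on the expression). Put $D=\frac1{|W|}\prod_{\alpha\in\Phi^+}\alpha\in R$, and for $w\in W$ let $X_w\in C$ be the image of $\Delta_{w^{-1}w_0}D$. Let $J\subseteq\Pi$, let $W_J=\langle s_\alpha\mid\alpha\in J\rangle$ with longest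 element $w_J$, let $W^J$ be the set of minimal length representatives of the left cosets $wW_J$ in $W$, and let $d_J$ be the unique element of $W^J$ with $w_0\in d_JW_J$. Let $C^J=C^{W_J}$ be the subalgebra of $W_J$-invariants of $C$, with the induced grading. Theorem. For every $d\in W^J$ the element $X_d$ lies in $C^J$, and the map $X_d\mapsto\delta_{d,d_J}$ ($d\in W^J$) extends uniquely to a $\mathbb C$-linear form $\mathrm{tr}_J\colon C^J\to\mathbb C$. This form is symmetrizing, that is, $\mathrm{tr}_J(xy)=\mathrm{tr}_J(yx)$ for all $x,y\in C^J$, and for every $x\neq0$ in $C^J$ there is $y\in C^J$ with $\mathrm{tr}_J(xy)\neq0$. It is homogeneous of degree $-2\ell(w_0)+2\ell(w_J)$, that is, it vanishes on the homogeneous part of $C^J$ of degree $k$ unless $k=2\ell(w_0)-2\ell(w_J)$. -/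

import Mathlib

noncomputable section

namespace RootPairing

variable {ι M N : Type*} [AddCommGroup M] [Module ℂ M] [AddCommGroup N] [Module ℂ N]

/-! ### The symmetric algebra and the coinvariant algebra -/

section Coinvariant

variable (P : RootPairing ι ℂ M N)

/-- The action of a Weyl group element on the symmetric algebra `R = S(M)`, by algebra
automorphisms extending the action on `M`. -/
def weylSym (w : P.weylGroup) : SymmetricAlgebra ℂ M →ₐ[ℂ] SymmetricAlgebra ℂ M :=
  SymmetricAlgebra.lift (SymmetricAlgebra.ι ℂ M ∘ₗ P.weylGroupRootRep w)

/-- The `j`-th symmetric power `S_j(M)` inside `S(M)`: the span of all products of `j` elements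
of `M`. -/
def symPower (M : Type*) [AddCommGroup M] [Module ℂ M] (j : ℕ) :
    Submodule ℂ (SymmetricAlgebra ℂ M) :=
  LinearMap.range (SymmetricAlgebra.ι ℂ M) ^ j

/-- The ideal `I_W` of `S(M)` generated by the `W`-invariants of positive degree. -/
def coinvariantIdeal : Ideal (SymmetricAlgebra ℂ M) :=
  Ideal.span {f | ∃ j, 1 ≤ j ∧ f ∈ symPower M j ∧ ∀ w : P.weylGroup, P.weylSym w f = f}

/-- The coinvariant algebra `C = S(M) / I_W`. -/
abbrev CoinvariantAlgebra : Type _ := SymmetricAlgebra ℂ M ⧸ P.coinvariantIdeal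

/-- The quotient map `S(M) → C`. -/
def toCoinvariant : SymmetricAlgebra ℂ M →ₐ[ℂ] P.CoinvariantAlgebra :=
  Ideal.Quotient.mkₐ ℂ P.coinvariantIdeal

lemma weylSym_mem_coinvariantIdeal (w : P.weylGroup) {f : SymmetricAlgebra ℂ M}
    (hf : f ∈ P.coinvariantIdeal) : P.weylSym w f ∈ P.coinvariantIdeal := by
  suffices h : P.coinvariantIdeal ≤ P.coinvariantIdeal.comap (P.weylSym w) from h hf
  refine Ideal.span_le.mpr ?_
  intro g hg
  have hg' : P.weylSym w g = g := hg.choose_spec.2.2 w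
  change P.weylSym w g ∈ P.coinvariantIdeal
  rw [hg']
  exact Ideal.subset_span hg

/-- The action of a Weyl group element on the coinvariant algebra. -/
def weylCoinvariant (w : P.weylGroup) : P.CoinvariantAlgebra →ₐ[ℂ] P.CoinvariantAlgebra :=
  Ideal.Quotient.liftₐ P.coinvariantIdeal (P.toCoinvariant.comp (P.weylSym w)) fun _ hf =>
    Ideal.Quotient.eq_zero_iff_mem.mpr (P.weylSym_mem_coinvariantIdeal w hf)

lemma weylCoinvariant_toCoinvariant (w : P.weylGroup) (f : SymmetricAlgebra ℂ M) :
    P.weylCoinvariant w (P.toCoinvariant f) = P.toCoinvariant (P.weylSym w f) := rfl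

/-- The `ℤ`-grading of the coinvariant algebra, with the elements of `M` in degree `2`: the piece
of degree `2 * j` is the image of `S_j(M)`, and all other pieces vanish. -/
def coinvariantDegree (k : ℤ) : Submodule ℂ P.CoinvariantAlgebra :=
  ⨆ (j : ℕ) (_ : 2 * (j : ℤ) = k), (symPower M j).map P.toCoinvariant.toLinearMap

lemma weylSym_reflection_ι (i : ι) (m : M) :
    P.weylSym (weylGroup.ofIdx P i) (SymmetricAlgebra.ι ℂ M m) =
      SymmetricAlgebra.ι ℂ M (P.reflection i m) := by
  rw [weylSym, SymmetricAlgebra.lift_ι_apply]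
  rfl

/-! ### Demazure operators -/

lemma root_dvd_sub_weylSym (i : ι) (f : SymmetricAlgebra ℂ M) :
    SymmetricAlgebra.ι ℂ M (P.root i) ∣ f - P.weylSym (weylGroup.ofIdx P i) f := by
  induction f using SymmetricAlgebra.induction with
  | algebraMap r => simp
  | ι m =>
    rw [weylSym_reflection_ι, ← map_sub, reflection_apply, sub_sub_cancel, map_smul]
    exact Dvd.intro_left (algebraMap ℂ _ _) (by rw [Algebra.smul_def])
  | mul a c ha hc =>
    have h : a * c - P.weylSym (weylGroup.ofIdx P i) (a * c) =
        (a - P.weylSym (weylGroup.ofIdx P i) a) * c +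
          P.weylSym (weylGroup.ofIdx P i) a * (c - P.weylSym (weylGroup.ofIdx P i) c) := by
      rw [map_mul]; ring
    rw [h]
    exact dvd_add (Dvd.dvd.mul_right ha _) (Dvd.dvd.mul_left hc _)
  | add a c ha hc =>
    have h : a + c - P.weylSym (weylGroup.ofIdx P i) (a + c) =
        (a - P.weylSym (weylGroup.ofIdx P i) a) + (c - P.weylSym (weylGroup.ofIdx P i) c) := by
      rw [map_add]; ring
    rw [h]
    exact dvd_add ha hc

lemma symι_root_ne_zero (i : ι) : SymmetricAlgebra.ι ℂ M (P.root i) ≠ 0 := by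
  intro h
  have h2 := SymmetricAlgebra.lift_ι_apply (f := P.coroot' i) (P.root i)
  rw [h, map_zero] at h2
  simp at h2

/-- The Demazure operator of a root `α`, that is `f ↦ (f - s_α f) / α`, where the quotient is the
unique `g` with `α * g = f - s_α f`. -/
def demazure (i : ι) : SymmetricAlgebra ℂ M →ₗ[ℂ] SymmetricAlgebra ℂ M where
  toFun f := (P.root_dvd_sub_weylSym i f).choose
  map_add' f g := by
    apply mul_left_cancel₀ (P.symι_root_ne_zero i)
    rw [mul_add, ← (P.root_dvd_sub_weylSym i f).choose_spec,
      ← (P.root_dvd_sub_weylSym i g).choose_spec,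
      ← (P.root_dvd_sub_weylSym i (f + g)).choose_spec, map_add]
    ring
  map_smul' r f := by
    apply mul_left_cancel₀ (P.symι_root_ne_zero i)
    rw [RingHom.id_apply, mul_smul_comm, ← (P.root_dvd_sub_weylSym i f).choose_spec,
      ← (P.root_dvd_sub_weylSym i (r • f)).choose_spec, map_smul, smul_sub]

lemma root_mul_demazure (i : ι) (f : SymmetricAlgebra ℂ M) :
    SymmetricAlgebra.ι ℂ M (P.root i) * P.demazure i f =
      f - P.weylSym (weylGroup.ofIdx P i) f :=
  (P.root_dvd_sub_weylSym i f).choose_spec.symm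

end Coinvariant

lemma finite_weylGroup [Finite ι] (P : RootPairing ι ℂ M N) [P.IsRootSystem] :
    Finite P.weylGroup := by
  refine Finite.of_injective (fun w : P.weylGroup => P.weylGroupToPerm w) ?_
  intro v w hvw
  apply Subtype.ext
  apply Equiv.weightHom_injective P
  apply LinearEquiv.toLinearMap_injective
  apply LinearMap.ext_on_range (v := P.root) IsRootSystem.span_root_eq_top
  intro i
  have hv := P.weylGroup_apply_root v i
  have hw := P.weylGroup_apply_root w i
  simp only at hvw
  rw [hvw, ← hw] at hv
  exact hv

namespace Base

variable {P : RootPairing ι ℂ M N} (b : P.Base)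

/-! ### Words, length, longest elements, minimal coset representatives -/

/-- The simple reflection `s_α` attached to a simple root. -/
def simpleReflection (i : b.support) : P.weylGroup := weylGroup.ofIdx P i

/-- The product in the Weyl group of a word in the simple reflections. -/
def wordProd (l : List b.support) : P.weylGroup := (l.map b.simpleReflection).prod

/-- The length function of the Weyl group with respect to the simple reflections. -/
def length (w : P.weylGroup) : ℕ := sInf {n | ∃ l : List b.support, b.wordProd l = w ∧ l.length = n}

lemma exists_wordProd [Finite ι] [P.IsCrystallographic] [P.IsReduced] (w : P.weylGroup) :
    ∃ l : List b.support, b.wordProd l = w := by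
  have hrefl (i : ι) : ∃ l : List b.support, b.wordProd l = weylGroup.ofIdx P i := by
    refine b.induction_reflect i (p := fun i => ∃ l, b.wordProd l = weylGroup.ofIdx P i) ?_ ?_ ?_
    · rintro i ⟨l, hl⟩
      refine ⟨l, hl.trans ?_⟩
      apply Subtype.ext
      apply Equiv.weightHom_injective P
      ext x
      change P.reflection i x = P.reflection (P.reflectionPerm i i) x
      rw [reflection_reflectionPerm]
      simp
    · intro i hi
      exact ⟨[⟨i, hi⟩], by simp [wordProd, simpleReflection]⟩
    · rintro i j ⟨l, hl⟩ hj
      refine ⟨⟨j, hj⟩ :: (l ++ [⟨j, hj⟩]), ?_⟩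
      have h : b.wordProd (⟨j, hj⟩ :: (l ++ [⟨j, hj⟩])) =
          weylGroup.ofIdx P j * (weylGroup.ofIdx P i * weylGroup.ofIdx P j) := by
        rw [← hl]; simp [wordProd, simpleReflection]
      rw [h]
      apply Subtype.ext
      apply Equiv.weightHom_injective P
      ext x
      change P.reflection j (P.reflection i (P.reflection j x)) =
        P.reflection (P.reflectionPerm j i) x
      rw [reflection_reflectionPerm]
      simp
  obtain ⟨w, hw⟩ := w
  induction hw using weylGroup.induction with
  | mem i => exact hrefl i
  | one => exact ⟨[], rfl⟩
  | mul x y hx hy ihx ihy =>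
    obtain ⟨l, hl⟩ := ihx
    obtain ⟨m, hm⟩ := ihy
    exact ⟨l ++ m, by simp only [wordProd, List.map_append, List.prod_append] at hl hm ⊢
                      rw [hl, hm]; rfl⟩

lemma exists_reducedWord [Finite ι] [P.IsCrystallographic] [P.IsReduced] (w : P.weylGroup) :
    ∃ l : List b.support, b.wordProd l = w ∧ l.length = b.length w := by
  obtain ⟨l, hl⟩ := b.exists_wordProd w
  exact Nat.sInf_mem (s := {n | ∃ l : List b.support, b.wordProd l = w ∧ l.length = n})
    ⟨l.length, l, hl, rfl⟩

/-- The standard parabolic subgroup `W_J`, generated by the `s_α` with `α ∈ J`. -/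
def parabolic (J : Set b.support) : Subgroup P.weylGroup :=
  Subgroup.closure (b.simpleReflection '' J)

/-- The set `W^J` of minimal length representatives of the left cosets `w W_J`. -/
def minCosetReps (J : Set b.support) : Set P.weylGroup :=
  {w | ∀ u ∈ b.parabolic J, b.length w ≤ b.length (w * u)}

section Longest

variable [Finite ι] [P.IsRootSystem]

lemma exists_longest (J : Set b.support) :
    ∃ w ∈ b.parabolic J, ∀ u ∈ b.parabolic J, b.length u ≤ b.length w := by
  have := P.finite_weylGroup
  obtain ⟨w, hw⟩ := Finite.exists_max (fun w : b.parabolic J => b.length w)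
  exact ⟨w, w.2, fun u hu => hw ⟨u, hu⟩⟩

/-- The longest element `w_J` of `W_J`. -/
def longestParabolic (J : Set b.support) : P.weylGroup := (b.exists_longest J).choose

lemma exists_longest_top : ∃ w : P.weylGroup, ∀ u, b.length u ≤ b.length w := by
  have := P.finite_weylGroup
  exact Finite.exists_max b.length

/-- The longest element `w₀` of `W`. -/
def longestElement : P.weylGroup := b.exists_longest_top.choose

lemma exists_longestRep (J : Set b.support) :
    ∃ d ∈ b.minCosetReps J, ∃ u ∈ b.parabolic J, b.longestElement = d * u := by
  have := P.finite_weylGroup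
  obtain ⟨u, hu⟩ := Finite.exists_min
    (fun u : b.parabolic J => b.length (b.longestElement * u))
  refine ⟨b.longestElement * u, fun v hv => ?_, (u : P.weylGroup)⁻¹, inv_mem u.2, by simp⟩
  have h := hu ⟨u * v, mul_mem u.2 hv⟩
  rwa [mul_assoc]

/-- The element `d_J` of `W^J` with `w₀ ∈ d_J W_J`. -/
def longestRep (J : Set b.support) : P.weylGroup := (b.exists_longestRep J).choose

end Longest

/-! ### The elements `X_w` of the coinvariant algebra -/

section Schubert

variable [Finite ι] [P.IsRootSystem] [P.IsCrystallographic] [P.IsReduced]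

/-- The Demazure operator `Δ_w`, the composition of the `Δ_{s_α}` along a reduced word of `w`.
By the braid relations it does not depend on the reduced word. -/
def demazureOp (w : P.weylGroup) : Module.End ℂ (SymmetricAlgebra ℂ M) :=
  ((b.exists_reducedWord w).choose.map fun i => (P.demazure i : Module.End ℂ _)).prod

/-- The element `D = |W|⁻¹ ∏_{α > 0} α` of `S(M)`. -/
def topElement : SymmetricAlgebra ℂ M :=
  (Nat.card P.weylGroup : ℂ)⁻¹ • ∏ᶠ (i : ι) (_ : b.IsPos i), SymmetricAlgebra.ι ℂ M (P.root i)

/-- The element `X_w` of the coinvariant algebra: the image of `Δ_{w⁻¹ w₀} D`. -/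
def schubertClass (w : P.weylGroup) : P.CoinvariantAlgebra :=
  P.toCoinvariant (b.demazureOp (w⁻¹ * b.longestElement) b.topElement)

end Schubert

/-- The subalgebra `C^J` of `W_J`-invariants of the coinvariant algebra. -/
def parabolicInvariants (J : Set b.support) : Subalgebra ℂ P.CoinvariantAlgebra where
  carrier := {x | ∀ w ∈ b.parabolic J, P.weylCoinvariant w x = x}
  mul_mem' hx hy w hw := by rw [map_mul, hx w hw, hy w hw]
  add_mem' hx hy w hw := by rw [map_add, hx w hw, hy w hw]
  algebraMap_mem' r w _ := (P.weylCoinvariant w).commutes r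

/-- The grading of `C^J` induced by that of the coinvariant algebra. -/
def parabolicDegree (J : Set b.support) (k : ℤ) : Submodule ℂ (b.parabolicInvariants J) :=
  (P.coinvariantDegree k).comap (b.parabolicInvariants J).val.toLinearMap

end Base

end RootPairing

/-! ### Symmetrizing forms -/

/-- A symmetrizing form on an algebra: a nondegenerate linear form `τ` with `τ (xy) = τ (yx)`. -/
structure IsSymmetrizingForm {K A : Type*} [Field K] [Ring A] [Algebra K A] (τ : A →ₗ[K] K) :
    Prop where
  trace : ∀ x y, τ (x * y) = τ (y * x)
  nondegenerate : ∀ x, x ≠ 0 → ∃ y, τ (x * y) ≠ 0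

/-- A linear form on a `ℤ`-graded space is homogeneous of degree `n` if it maps the piece of degree
`k` into the piece of degree `k + n` of `K`, where `K` is concentrated in degree `0`. -/
def IsHomogeneousForm {K A : Type*} [Field K] [AddCommGroup A] [Module K A]
    (𝒜 : ℤ → Submodule K A) (n : ℤ) (τ : A →ₗ[K] K) : Prop :=
  ∀ k, k + n ≠ 0 → ∀ x ∈ 𝒜 k, τ x = 0

end

set_option linter.unusedSectionVars false

noncomputable section

namespace RootPairing

variable {ι M N : Type*} [AddCommGroup M] [Module ℂ M] [AddCommGroup N] [Module ℂ N]

/-! ### The Weyl group acting on roots, coroots and weights. -/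

section WeylAction

variable (P : RootPairing ι ℂ M N)

/-! The linear forms `coefficient w`, sending x to the constant term of `Δ_w x`, are up to one
nonzero scalar the dual basis of the `X_w`; the trace is the rescaled form attached to `d_J`.

Duality rests on two facts. First, `Δ_v Δ_w` is `Δ_{vw}` if lengths add and zero otherwise
(`demazureWord_eq_aux`). Instead of checking braid relations, the proof expands `Δ_{i₁} ⋯ Δ_{iₖ} (m
f)` by the Leibniz rule as a sum over the words with one letter deleted (`demazureWord_ι_mul`). For
a reduced word these correspond to the inversions of its product, so by induction the difference of
the operators of two reduced words of `w` satisfies `T (f g) = w(f) T g`, and it kills 1. Second,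
the scalar `Δ_{w₀} D` is nonzero: otherwise antisymmetrization shows `Δ_{w₀} = 0`, whereas `Δ_w` has
a positive value on a power of a dominant weight (`exists_constantTerm_demazureWord_pow`). By
degree, `Δ_v X_w` then has nonzero constant term only for `v = w`. An averaging argument shows that
the coefficients separate points of `C` (`mem_coinvariantIdeal_of_forall_demazureOp`), so the `X_w`
form a basis.

On `C^J` the coefficients outside `W^J` vanish, since such a `Δ_w` applies some `Δ_i` with `i ∈ J`
first, while `X_d` is `W_J`-invariant for `d ∈ W^J`. Hence the trace exists and is unique, and its
degree comes from `ℓ(d_J) = ℓ(w₀) - ℓ(w_J)`.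

For nondegeneracy, the `Δ_i` are self-adjoint for the form `Δ_{w₀} (x y)` on `C`, which is therefore
nondegenerate. Put `u = d_J⁻¹ w₀ ∈ W_J`. Then `Δ_{w₀} = Δ_{d_J} Δ_u` and `Δ_u` is `C^J`-linear, so
`Δ_{w₀} (x z) = Δ_{d_J} (x Δ_u z)` for `x ∈ C^J`, with `Δ_u z ∈ C^J`. -/

lemma root_weylGroup_smul (w : P.weylGroup) (i : ι) : P.root (w • i) = w • P.root i :=
  (P.weylGroup_apply_root w i).symm

lemma ofIdx_smul_eq_reflection (i : ι) (m : M) : weylGroup.ofIdx P i • m = P.reflection i m := rfl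

lemma ofIdx_smul_index (i j : ι) : weylGroup.ofIdx P i • j = P.reflectionPerm i j := rfl

lemma weylGroup_ext {v w : P.weylGroup} (h : ∀ m : M, v • m = w • m) : v = w := by
  apply Subtype.ext
  apply Equiv.weightHom_injective P
  ext m
  exact h m

lemma ofIdx_mul_self (i : ι) : weylGroup.ofIdx P i * weylGroup.ofIdx P i = 1 :=
  P.weylGroup_ext fun m => by
    rw [mul_smul, ofIdx_smul_eq_reflection, ofIdx_smul_eq_reflection, one_smul]
    simp

lemma ofIdx_inv (i : ι) : (weylGroup.ofIdx P i)⁻¹ = weylGroup.ofIdx P i :=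
  inv_eq_of_mul_eq_one_left (P.ofIdx_mul_self i)

lemma root_neg_index (i : ι) : P.root (P.reflectionPerm i i) = -P.root i := by
  rw [root_reflectionPerm, reflection_apply_self]

lemma weylGroup_smul_neg_index (w : P.weylGroup) (i : ι) :
    w • P.reflectionPerm i i = P.reflectionPerm (w • i) (w • i) := by
  apply P.root.injective
  rw [root_weylGroup_smul, root_neg_index, root_neg_index, root_weylGroup_smul]
  exact map_neg (P.weylGroupRootRep w) (P.root i)

lemma ofIdx_neg_index (i : ι) : weylGroup.ofIdx P (P.reflectionPerm i i) = weylGroup.ofIdx P i :=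
  P.weylGroup_ext fun m => by
    rw [ofIdx_smul_eq_reflection, ofIdx_smul_eq_reflection, reflection_reflectionPerm]
    simp

lemma coroot'_weylGroup_smul (w : P.weylGroup) (i : ι) (m : M) :
    P.coroot' (w • i) (w • m) = P.coroot' i m := by
  obtain ⟨w, hw⟩ := w
  induction hw using weylGroup.induction generalizing i m with
  | mem j =>
    change P.coroot' (P.reflectionPerm j i) (P.reflection j m) = _
    rw [coroot'_reflectionPerm]
    simp
  | one => exact congrArg _ rfl
  | mul x y hx hy ihx ihy => exact (ihx _ _).trans (ihy _ _)

lemma weylGroup_smul_sub (w : P.weylGroup) (m n : M) : w • (m - n) = w • m - w • n :=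
  map_sub (P.weylGroupRootRep w) m n

lemma weylGroup_smul_smul (w : P.weylGroup) (c : ℂ) (m : M) : w • (c • m) = c • w • m :=
  map_smul (P.weylGroupRootRep w) c m

lemma ofIdx_weylGroup_smul_mul (w : P.weylGroup) (i : ι) :
    weylGroup.ofIdx P (w • i) * w = w * weylGroup.ofIdx P i :=
  P.weylGroup_ext fun m => by
    rw [mul_smul, mul_smul, ofIdx_smul_eq_reflection, ofIdx_smul_eq_reflection, reflection_apply,
      reflection_apply, coroot'_weylGroup_smul, root_weylGroup_smul, weylGroup_smul_sub,
      weylGroup_smul_smul]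

end WeylAction

namespace Base

variable {P : RootPairing ι ℂ M N} (b : P.Base)

/-! ### Words and inversions -/

lemma wordProd_nil : b.wordProd [] = 1 := rfl

lemma wordProd_cons (i : b.support) (l : List b.support) :
    b.wordProd (i :: l) = weylGroup.ofIdx P i * b.wordProd l := by
  simp [wordProd, simpleReflection]

lemma wordProd_append (l m : List b.support) :
    b.wordProd (l ++ m) = b.wordProd l * b.wordProd m := by
  simp [wordProd]

lemma wordProd_reverse (l : List b.support) : b.wordProd l.reverse = (b.wordProd l)⁻¹ := by
  induction l with
  | nil => simp [wordProd]
  | cons i l ih =>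
    rw [List.reverse_cons, wordProd_append, ih, wordProd_cons, wordProd_cons, wordProd_nil, mul_one,
      mul_inv_rev, ofIdx_inv]

lemma length_wordProd_le (l : List b.support) : b.length (b.wordProd l) ≤ l.length :=
  Nat.sInf_le ⟨l, rfl, rfl⟩

lemma length_one : b.length (1 : P.weylGroup) = 0 :=
  Nat.le_zero.mp (b.length_wordProd_le [])

/-- A word is reduced if it is as short as possible among the words with the same product. -/
def IsReducedWord (l : List b.support) : Prop := b.length (b.wordProd l) = l.length

/-- The words obtained by deleting one letter of a given word `l`, each paired with the root `β`
such that its product is `wordProd l * s_β`. -/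
def deletions : List b.support → List (ι × List b.support)
  | [] => []
  | i :: l => ((b.wordProd l)⁻¹ • (i : ι), l) :: (deletions l).map fun p => (p.1, i :: p.2)

lemma length_of_mem_deletions {l : List b.support} {p : ι × List b.support}
    (hp : p ∈ b.deletions l) : p.2.length + 1 = l.length := by
  induction l generalizing p with
  | nil => simp [deletions] at hp
  | cons i l ih =>
    simp only [deletions, List.mem_cons, List.mem_map] at hp
    obtain rfl | ⟨q, hq, rfl⟩ := hp
    · rfl
    · simpa using ih hq

lemma sublist_of_mem_deletions {l : List b.support} {p : ι × List b.support}
    (hp : p ∈ b.deletions l) : p.2.Sublist l := by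
  induction l generalizing p with
  | nil => simp [deletions] at hp
  | cons i l ih =>
    simp only [deletions, List.mem_cons, List.mem_map] at hp
    obtain rfl | ⟨q, hq, rfl⟩ := hp
    · exact List.sublist_cons_self i l
    · exact (ih hq).cons_cons i

/-- A letter `s_i` followed by a suffix `v` satisfies `s_i v = v s_β` with `β = v⁻¹ α_i`, so
deleting it amounts to multiplying by `s_β` on the right. -/
lemma wordProd_of_mem_deletions {l : List b.support} {p : ι × List b.support}
    (hp : p ∈ b.deletions l) : b.wordProd p.2 = b.wordProd l * weylGroup.ofIdx P p.1 := by
  induction l generalizing p with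
  | nil => simp [deletions] at hp
  | cons i l ih =>
    simp only [deletions, List.mem_cons, List.mem_map] at hp
    obtain rfl | ⟨q, hq, rfl⟩ := hp
    · rw [wordProd_cons, mul_assoc, ← ofIdx_weylGroup_smul_mul, smul_inv_smul, ← mul_assoc,
        ofIdx_mul_self, one_mul]
    · rw [wordProd_cons, wordProd_cons, ih hq, mul_assoc]

lemma length_deletions (l : List b.support) : (b.deletions l).length = l.length := by
  induction l with
  | nil => rfl
  | cons i l ih => simp [deletions, ih]

lemma isPos_neg_index_iff (i : ι) : b.IsPos (P.reflectionPerm i i) ↔ ¬ b.IsPos i :=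
  IsPos.neg_iff_not b i


/-! ### Exchange and deletion properties, and length as the number of inversions. -/

section Finite

variable [Finite ι] [P.IsCrystallographic] [P.IsReduced]

lemma length_le_of_mul {u v : P.weylGroup} : b.length (u * v) ≤ b.length u + b.length v := by
  obtain ⟨l, hl, hl'⟩ := b.exists_reducedWord u
  obtain ⟨m, hm, hm'⟩ := b.exists_reducedWord v
  rw [← hl', ← hm', ← List.length_append, ← hl, ← hm, ← wordProd_append]
  exact b.length_wordProd_le _

lemma length_inv (w : P.weylGroup) : b.length w⁻¹ = b.length w := by
  have h (v : P.weylGroup) : b.length v⁻¹ ≤ b.length v := by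
    obtain ⟨l, hl, hl'⟩ := b.exists_reducedWord v
    rw [← hl', ← hl, ← wordProd_reverse, ← List.length_reverse]
    exact b.length_wordProd_le _
  exact le_antisymm (h w) (by simpa using h w⁻¹)

variable {b} in
lemma IsReducedWord.of_append {l m : List b.support} (h : b.IsReducedWord (l ++ m)) :
    b.IsReducedWord l ∧ b.IsReducedWord m := by
  have h1 := b.length_le_of_mul (u := b.wordProd l) (v := b.wordProd m)
  rw [← wordProd_append, h, List.length_append] at h1
  have h2 := b.length_wordProd_le l
  have h3 := b.length_wordProd_le m
  constructor <;> unfold IsReducedWord <;> omega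

variable {b} in
lemma IsReducedWord.of_cons {i : b.support} {l : List b.support} (h : b.IsReducedWord (i :: l)) :
    b.IsReducedWord l :=
  (IsReducedWord.of_append (l := [i]) h).2

lemma eq_of_isPos_of_not_isPos_ofIdx_smul {i : b.support} {j : ι} (hj : b.IsPos j)
    (h : ¬ b.IsPos (weylGroup.ofIdx P i • j)) : j = i := by
  by_contra hij
  exact h (hj.reflectionPerm i.2 hij)

/-- The positive roots made negative by a Weyl group element. -/
def inversions (w : P.weylGroup) : Set ι := {j | b.IsPos j ∧ ¬ b.IsPos (w • j)}

/-- Reading the word from the right, the root must change sign at some letter, and only the simple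
root of that letter does so. The word need not be reduced; with `wordProd_of_mem_deletions` this is
the exchange condition. -/
lemma mem_deletions_of_mem_inversions (l : List b.support) {j : ι}
    (hj : j ∈ b.inversions (b.wordProd l)) : j ∈ (b.deletions l).map Prod.fst := by
  induction l with
  | nil => exact absurd (by simpa [wordProd_nil] using hj.1) hj.2
  | cons i l ih =>
    obtain ⟨h1, h2⟩ := hj
    simp only [deletions, List.map_cons, List.map_map, Function.comp_def, List.mem_cons]
    by_cases h : b.IsPos (b.wordProd l • j)
    · rw [wordProd_cons, mul_smul] at h2
      left
      rw [← b.eq_of_isPos_of_not_isPos_ofIdx_smul h h2, inv_smul_smul]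
    · exact Or.inr (ih ⟨h1, h⟩)

/-- Otherwise the opposite root is an inversion of the tail, and the exchange condition rewrites the
whole product with two letters fewer. -/
lemma isPos_inv_smul_of_isReducedWord {i : b.support} {l : List b.support}
    (h : b.IsReducedWord (i :: l)) : b.IsPos ((b.wordProd l)⁻¹ • (i : ι)) := by
  by_contra hneg
  rw [← isPos_neg_index_iff] at hneg
  have hmem : P.reflectionPerm ((b.wordProd l)⁻¹ • (i : ι)) ((b.wordProd l)⁻¹ • (i : ι)) ∈
      b.inversions (b.wordProd l) := by
    refine ⟨hneg, ?_⟩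
    rw [weylGroup_smul_neg_index, smul_inv_smul, isPos_neg_index_iff, not_not]
    exact b.isPos_of_mem_support i.2
  have hdel := b.mem_deletions_of_mem_inversions l hmem
  obtain ⟨p, hp, hp1⟩ := List.mem_map.mp hdel
  have h1 := b.wordProd_of_mem_deletions hp
  have h2 := b.length_of_mem_deletions hp
  rw [hp1, ofIdx_neg_index, ← ofIdx_weylGroup_smul_mul, smul_inv_smul, ← wordProd_cons] at h1
  have h3 := b.length_wordProd_le p.2
  rw [h1, h] at h3
  simp at h3
  omega

lemma IsReducedWord.nodup_and_mem_inversions {l : List b.support} (h : b.IsReducedWord l) :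
    ((b.deletions l).map Prod.fst).Nodup ∧
      ∀ j, j ∈ (b.deletions l).map Prod.fst ↔ j ∈ b.inversions (b.wordProd l) := by
  induction l with
  | nil =>
    refine ⟨by simp [deletions], fun j => ⟨by simp [deletions], ?_⟩⟩
    exact b.mem_deletions_of_mem_inversions []
  | cons i l ih =>
    obtain ⟨ih1, ih2⟩ := ih h.of_cons
    have hpos := b.isPos_inv_smul_of_isReducedWord h
    have hi := b.isPos_of_mem_support i.2
    have hfst : (b.deletions (i :: l)).map Prod.fst =
        (b.wordProd l)⁻¹ • (i : ι) :: (b.deletions l).map Prod.fst := by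
      simp [deletions, Function.comp_def]
    refine ⟨?_, fun j => ⟨fun hj => ?_, b.mem_deletions_of_mem_inversions _⟩⟩
    · rw [hfst, List.nodup_cons]
      refine ⟨fun hmem => ?_, ih1⟩
      have := ((ih2 _).mp hmem).2
      rw [smul_inv_smul] at this
      exact this hi
    · rw [hfst, List.mem_cons] at hj
      rw [wordProd_cons]
      obtain rfl | hj := hj
      · refine ⟨hpos, ?_⟩
        rw [mul_smul, smul_inv_smul, ofIdx_smul_index, isPos_neg_index_iff, not_not]
        exact hi
      · obtain ⟨h1, h2⟩ := (ih2 _).mp hj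
        refine ⟨h1, fun h3 => ?_⟩
        rw [mul_smul] at h3
        -- If `s_i` turned an inversion of the tail positive again, the tail would send `j` to
        -- `-α_i`, making `j` the negative of the positive root `hpos`.
        have h4 := b.eq_of_isPos_of_not_isPos_ofIdx_smul (i := i) h3
          (by rw [← mul_smul, ofIdx_mul_self, one_smul]; exact h2)
        have h5 : b.wordProd l • j = P.reflectionPerm i i := by
          rw [← ofIdx_smul_index, ← inv_smul_eq_iff, ofIdx_inv]
          exact h4
        have h6 : j =
            P.reflectionPerm ((b.wordProd l)⁻¹ • (i : ι)) ((b.wordProd l)⁻¹ • (i : ι)) := by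
          rw [← weylGroup_smul_neg_index, ← h5, inv_smul_smul]
        rw [h6, isPos_neg_index_iff] at h1
        exact h1 hpos

lemma length_eq_ncard_inversions (w : P.weylGroup) : b.length w = (b.inversions w).ncard := by
  classical
  obtain ⟨l, rfl, hl⟩ := b.exists_reducedWord w
  obtain ⟨h1, h2⟩ := IsReducedWord.nodup_and_mem_inversions b hl.symm
  have : b.inversions (b.wordProd l) = (((b.deletions l).map Prod.fst).toFinset : Set ι) := by
    ext j
    simpa using (h2 j).symm
  rw [this, Set.ncard_coe_finset, List.toFinset_card_of_nodup h1, List.length_map,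
    length_deletions, hl]

lemma length_mul_ofIdx_lt {w : P.weylGroup} {i : b.support} (h : ¬ b.IsPos (w • (i : ι))) :
    b.length (w * weylGroup.ofIdx P i) + 1 = b.length w := by
  obtain ⟨l, rfl, hl⟩ := b.exists_reducedWord w
  have hi := b.isPos_of_mem_support i.2
  obtain ⟨p, hp, hp1⟩ := List.mem_map.mp (b.mem_deletions_of_mem_inversions l ⟨hi, h⟩)
  have h1 := b.wordProd_of_mem_deletions hp
  have h2 := b.length_of_mem_deletions hp
  have h3 := b.length_wordProd_le p.2
  rw [h1, hp1] at h3
  have h4 := b.length_le_of_mul (u := b.wordProd l * weylGroup.ofIdx P i)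
    (v := b.wordProd [i])
  rw [wordProd_cons, wordProd_nil, mul_one, mul_assoc, ofIdx_mul_self, mul_one] at h4
  have h5 := b.length_wordProd_le [i]
  rw [wordProd_cons, wordProd_nil, mul_one, List.length_singleton] at h5
  omega

lemma length_mul_ofIdx_gt {w : P.weylGroup} {i : b.support} (h : b.IsPos (w • (i : ι))) :
    b.length (w * weylGroup.ofIdx P i) = b.length w + 1 := by
  have := b.length_mul_ofIdx_lt (w := w * weylGroup.ofIdx P i) (i := i) (by
    rwa [mul_smul, ofIdx_smul_index, weylGroup_smul_neg_index, isPos_neg_index_iff, not_not])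
  rw [mul_assoc, ofIdx_mul_self, mul_one] at this
  exact this.symm

lemma length_mul_ofIdx (w : P.weylGroup) (i : b.support) :
    b.length (w * weylGroup.ofIdx P i) = b.length w + 1 ∨
      b.length (w * weylGroup.ofIdx P i) + 1 = b.length w := by
  by_cases h : b.IsPos (w • (i : ι))
  · exact Or.inl (b.length_mul_ofIdx_gt h)
  · exact Or.inr (b.length_mul_ofIdx_lt h)

lemma length_ofIdx_mul (w : P.weylGroup) (i : b.support) :
    b.length (weylGroup.ofIdx P i * w) = b.length w + 1 ∨
      b.length (weylGroup.ofIdx P i * w) + 1 = b.length w := by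
  have := b.length_mul_ofIdx w⁻¹ i
  rwa [length_inv, ← length_inv, mul_inv_rev, ofIdx_inv, inv_inv] at this

lemma length_ofIdx (i : b.support) : b.length (weylGroup.ofIdx P (i : ι)) = 1 := by
  have := b.length_mul_ofIdx 1 i
  rw [one_mul, length_one] at this
  omega

lemma eq_one_of_length_eq_zero {w : P.weylGroup} (h : b.length w = 0) : w = 1 := by
  obtain ⟨l, rfl, hl⟩ := b.exists_reducedWord w
  rw [h, List.length_eq_zero_iff] at hl
  rw [hl, wordProd_nil]

/-- The deletion property. Keeping a sublist, rather than just some reduced word, controls which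
letters occur: this is what parabolic subgroups and cosets need. -/
lemma exists_isReducedWord_sublist (l : List b.support) :
    ∃ m : List b.support, m.Sublist l ∧ b.wordProd m = b.wordProd l ∧ b.IsReducedWord m := by
  induction l with
  | nil => exact ⟨[], by simp, rfl, b.length_one⟩
  | cons i l ih =>
    obtain ⟨m, hm1, hm2, hm3⟩ := ih
    obtain h | h := b.length_ofIdx_mul (b.wordProd m) i
    · refine ⟨i :: m, hm1.cons_cons i, by rw [wordProd_cons, wordProd_cons, hm2], ?_⟩
      rw [IsReducedWord, wordProd_cons, h, hm3, List.length_cons]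
    · have hneg : ¬ b.IsPos ((b.wordProd m)⁻¹ • (i : ι)) := fun hpos => by
        have := b.length_mul_ofIdx_gt hpos
        rw [← length_inv, mul_inv_rev, ofIdx_inv, inv_inv, length_inv] at this
        omega
      rw [← isPos_neg_index_iff] at hneg
      have hmem : P.reflectionPerm ((b.wordProd m)⁻¹ • (i : ι)) ((b.wordProd m)⁻¹ • (i : ι)) ∈
          b.inversions (b.wordProd m) := by
        refine ⟨hneg, ?_⟩
        rw [weylGroup_smul_neg_index, smul_inv_smul, isPos_neg_index_iff, not_not]
        exact b.isPos_of_mem_support i.2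
      obtain ⟨p, hp, hp1⟩ := List.mem_map.mp (b.mem_deletions_of_mem_inversions m hmem)
      have h1 := b.wordProd_of_mem_deletions hp
      rw [hp1, ofIdx_neg_index, ← ofIdx_weylGroup_smul_mul, smul_inv_smul, ← wordProd_cons] at h1
      refine ⟨p.2, ((b.sublist_of_mem_deletions hp).trans hm1).trans (List.sublist_cons_self i l),
        by rw [h1, wordProd_cons, wordProd_cons, hm2], ?_⟩
      have h2 := b.length_of_mem_deletions hp
      rw [IsReducedWord, h1, wordProd_cons]
      rw [hm3] at h
      omega

lemma exists_isReducedWord_of_mem_parabolic {J : Set b.support} {u : P.weylGroup}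
    (hu : u ∈ b.parabolic J) :
    ∃ l : List b.support, (∀ i ∈ l, i ∈ J) ∧ b.wordProd l = u ∧ b.IsReducedWord l := by
  suffices h : ∃ l : List b.support, (∀ i ∈ l, i ∈ J) ∧ b.wordProd l = u by
    obtain ⟨l, hl, rfl⟩ := h
    obtain ⟨m, hm1, hm2, hm3⟩ := b.exists_isReducedWord_sublist l
    exact ⟨m, fun i hi => hl i (hm1.subset hi), hm2, hm3⟩
  induction hu using Subgroup.closure_induction with
  | mem x hx =>
    obtain ⟨i, hi, rfl⟩ := hx
    exact ⟨[i], by simpa using hi, by simp [wordProd]⟩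
  | one => exact ⟨[], by simp, rfl⟩
  | mul x y _ _ hx hy =>
    obtain ⟨l, hl, rfl⟩ := hx
    obtain ⟨m, hm, rfl⟩ := hy
    refine ⟨l ++ m, fun i hi => ?_, b.wordProd_append l m⟩
    exact (List.mem_append.mp hi).elim (hl i) (hm i)
  | inv x _ hx =>
    obtain ⟨l, hl, rfl⟩ := hx
    exact ⟨l.reverse, fun i hi => hl i (List.mem_reverse.mp hi), b.wordProd_reverse l⟩

/-! ### The longest element -/

section Longest

variable [P.IsRootSystem]

/-- A simple root kept positive would allow a longer element; the other positive roots are reached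
by adding simple roots. -/
lemma not_isPos_longestElement_smul {j : ι} (hj : b.IsPos j) :
    ¬ b.IsPos (b.longestElement • j) := by
  have hmax : ∀ u, b.length u ≤ b.length b.longestElement := b.exists_longest_top.choose_spec
  have hsimple (i : ι) (hi : i ∈ b.support) : ¬ b.IsPos (b.longestElement • i) := fun h => by
    have h1 := b.length_mul_ofIdx_gt (i := ⟨i, hi⟩) h
    have h2 := hmax (b.longestElement * weylGroup.ofIdx P i)
    simp only at h1
    omega
  refine hj.induction_on_add hsimple fun i j k hk hi hj => ?_
  rw [← isPos_neg_index_iff] at hi ⊢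
  have hj' := hsimple j hj
  rw [← isPos_neg_index_iff] at hj'
  refine hi.add hj' ?_
  rw [root_neg_index, root_neg_index, root_neg_index, root_weylGroup_smul, hk, smul_add,
    root_weylGroup_smul, root_weylGroup_smul, neg_add]

lemma isPos_longestElement_smul_iff (j : ι) :
    b.IsPos (b.longestElement • j) ↔ ¬ b.IsPos j := by
  refine ⟨fun h hj => b.not_isPos_longestElement_smul hj h, fun h => ?_⟩
  rw [← isPos_neg_index_iff] at h
  have := b.not_isPos_longestElement_smul h
  rwa [weylGroup_smul_neg_index, isPos_neg_index_iff, not_not] at this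

/-- The bijection `j ↦ -w₀ j` carries the inversions of `w w₀` to the positive roots that are not
inversions of `w`. -/
lemma length_mul_longestElement (w : P.weylGroup) :
    b.length (w * b.longestElement) + b.length w = {j | b.IsPos j}.ncard := by
  have h1 : (fun j => P.reflectionPerm (b.longestElement • j) (b.longestElement • j)) ''
      b.inversions (w * b.longestElement) = {j | b.IsPos j} \ b.inversions w := by
    have hneg (j : ι) : P.reflectionPerm (P.reflectionPerm j j) (P.reflectionPerm j j) = j := by
      let := P.indexNeg
      exact neg_neg j
    ext j
    constructor
    · rintro ⟨k, ⟨hk1, hk2⟩, rfl⟩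
      rw [mul_smul] at hk2
      refine ⟨?_, fun h => h.2 ?_⟩
      · change b.IsPos _
        rw [isPos_neg_index_iff, isPos_longestElement_smul_iff, not_not]
        exact hk1
      · rwa [weylGroup_smul_neg_index, isPos_neg_index_iff]
    · rintro ⟨hj1, hj2⟩
      have hj3 : b.IsPos (w • j) := by
        by_contra h
        exact hj2 ⟨hj1, h⟩
      refine ⟨b.longestElement⁻¹ • P.reflectionPerm j j, ⟨?_, ?_⟩, ?_⟩
      · rw [← not_not (a := b.IsPos _), ← isPos_longestElement_smul_iff, smul_inv_smul,
          isPos_neg_index_iff, not_not]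
        exact hj1
      · rw [mul_smul, smul_inv_smul, weylGroup_smul_neg_index, isPos_neg_index_iff, not_not]
        exact hj3
      · simp only [smul_inv_smul, hneg]
  have hinj : Function.Injective
      fun j => P.reflectionPerm (b.longestElement • j) (b.longestElement • j) := by
    intro i j hij
    simp only [← weylGroup_smul_neg_index] at hij
    have := MulAction.injective _ hij
    let _ := P.indexNeg
    exact neg_injective this
  rw [length_eq_ncard_inversions, length_eq_ncard_inversions, ← Set.ncard_image_of_injective _ hinj,
    h1]
  exact Set.ncard_sdiff_add_ncard_of_subset (fun j hj => hj.1)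

lemma length_longestElement : b.length b.longestElement = {j | b.IsPos j}.ncard := by
  have := b.length_mul_longestElement 1
  rwa [one_mul, length_one, add_zero] at this

lemma longestElement_mul_self : b.longestElement * b.longestElement = 1 := by
  apply b.eq_one_of_length_eq_zero
  have := b.length_mul_longestElement b.longestElement
  rw [length_longestElement] at this
  omega

lemma longestElement_inv : b.longestElement⁻¹ = b.longestElement :=
  inv_eq_of_mul_eq_one_left b.longestElement_mul_self

lemma length_inv_mul_longestElement (w : P.weylGroup) :
    b.length (w⁻¹ * b.longestElement) + b.length w = b.length b.longestElement := by
  rw [length_longestElement, ← b.length_mul_longestElement w⁻¹, b.length_inv w]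

lemma length_longestElement_mul (w : P.weylGroup) :
    b.length (b.longestElement * w) + b.length w = b.length b.longestElement := by
  rw [← length_inv, mul_inv_rev, longestElement_inv, length_inv_mul_longestElement]

lemma eq_longestElement_of_length_eq {w : P.weylGroup}
    (h : b.length w = b.length b.longestElement) : w = b.longestElement := by
  have h1 := b.length_longestElement_mul w
  have h2 : b.longestElement * w = 1 := b.eq_one_of_length_eq_zero (by omega)
  rw [← longestElement_inv]
  exact eq_inv_of_mul_eq_one_right h2

end Longest

end Finite

end Base

section Operators

variable (P : RootPairing ι ℂ M N)

/-! ### The Weyl group action and Demazure operators on the symmetric algebra -/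

lemma weylSym_ι (w : P.weylGroup) (m : M) :
    P.weylSym w (SymmetricAlgebra.ι ℂ M m) = SymmetricAlgebra.ι ℂ M (w • m) := by
  rw [weylSym, SymmetricAlgebra.lift_ι_apply]
  rfl

lemma weylSym_one (f : SymmetricAlgebra ℂ M) : P.weylSym 1 f = f := by
  have h : P.weylSym 1 = AlgHom.id ℂ _ := by
    ext m
    change P.weylSym 1 (SymmetricAlgebra.ι ℂ M m) = _
    rw [weylSym_ι, one_smul]
    rfl
  rw [h, AlgHom.id_apply]

lemma weylSym_mul (v w : P.weylGroup) (f : SymmetricAlgebra ℂ M) :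
    P.weylSym (v * w) f = P.weylSym v (P.weylSym w f) := by
  have h : P.weylSym (v * w) = (P.weylSym v).comp (P.weylSym w) := by
    ext m
    change P.weylSym (v * w) (SymmetricAlgebra.ι ℂ M m) =
      P.weylSym v (P.weylSym w (SymmetricAlgebra.ι ℂ M m))
    rw [weylSym_ι, weylSym_ι, weylSym_ι, mul_smul]
  rw [h, AlgHom.comp_apply]

lemma weylSym_ofIdx_ofIdx (i : ι) (f : SymmetricAlgebra ℂ M) :
    P.weylSym (weylGroup.ofIdx P i) (P.weylSym (weylGroup.ofIdx P i) f) = f := by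
  rw [← weylSym_mul, ofIdx_mul_self, weylSym_one]

lemma weylSym_root (w : P.weylGroup) (i : ι) :
    P.weylSym w (SymmetricAlgebra.ι ℂ M (P.root i)) = SymmetricAlgebra.ι ℂ M (P.root (w • i)) := by
  rw [weylSym_ι, root_weylGroup_smul]

lemma weylSym_ofIdx_root (i : ι) :
    P.weylSym (weylGroup.ofIdx P i) (SymmetricAlgebra.ι ℂ M (P.root i)) =
      -SymmetricAlgebra.ι ℂ M (P.root i) := by
  rw [weylSym_root, ofIdx_smul_index, root_neg_index, map_neg]

lemma demazure_unique {i : ι} {f g : SymmetricAlgebra ℂ M}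
    (h : SymmetricAlgebra.ι ℂ M (P.root i) * g = f - P.weylSym (weylGroup.ofIdx P i) f) :
    P.demazure i f = g :=
  mul_left_cancel₀ (P.symι_root_ne_zero i) ((P.root_mul_demazure i f).trans h.symm)

lemma demazure_mul (i : ι) (f g : SymmetricAlgebra ℂ M) :
    P.demazure i (f * g) =
      P.demazure i f * g + P.weylSym (weylGroup.ofIdx P i) f * P.demazure i g := by
  apply demazure_unique
  rw [mul_add, ← mul_assoc, root_mul_demazure, mul_left_comm, root_mul_demazure, map_mul]
  ring

lemma demazure_ι (i : ι) (m : M) :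
    P.demazure i (SymmetricAlgebra.ι ℂ M m) = algebraMap ℂ _ (P.coroot' i m) := by
  apply demazure_unique
  rw [weylSym_reflection_ι, ← map_sub, reflection_apply, sub_sub_cancel, map_smul, mul_comm,
    Algebra.smul_def]

lemma demazure_of_invariant {i : ι} {f : SymmetricAlgebra ℂ M}
    (h : P.weylSym (weylGroup.ofIdx P i) f = f) : P.demazure i f = 0 := by
  apply demazure_unique
  rw [h, mul_zero, sub_self]

lemma weylSym_demazure (i : ι) (f : SymmetricAlgebra ℂ M) :
    P.weylSym (weylGroup.ofIdx P i) (P.demazure i f) = P.demazure i f := by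
  apply mul_left_cancel₀ (P.symι_root_ne_zero i)
  have h := congrArg (P.weylSym (weylGroup.ofIdx P i)) (P.root_mul_demazure i f)
  rw [map_mul, weylSym_ofIdx_root, map_sub, weylSym_ofIdx_ofIdx] at h
  rw [root_mul_demazure, ← neg_sub, ← h]
  ring

lemma demazure_demazure (i : ι) (f : SymmetricAlgebra ℂ M) :
    P.demazure i (P.demazure i f) = 0 :=
  P.demazure_of_invariant (P.weylSym_demazure i f)

lemma demazure_ι_mul (i : ι) (m : M) (f : SymmetricAlgebra ℂ M) :
    P.demazure i (SymmetricAlgebra.ι ℂ M m * f) =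
      SymmetricAlgebra.ι ℂ M (weylGroup.ofIdx P i • m) * P.demazure i f + P.coroot' i m • f := by
  rw [demazure_mul, demazure_ι, weylSym_ι, Algebra.smul_def, add_comm]

/-! ### Degrees and constant terms -/

/-- The constant term of an element of the symmetric algebra. -/
def constantTerm (M : Type*) [AddCommGroup M] [Module ℂ M] : SymmetricAlgebra ℂ M →ₐ[ℂ] ℂ :=
  SymmetricAlgebra.algebraMapInv

lemma constantTerm_ι (m : M) : constantTerm M (SymmetricAlgebra.ι ℂ M m) = 0 :=
  SymmetricAlgebra.algebraMapInv_ι m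

lemma ι_mem_range (m : M) :
    SymmetricAlgebra.ι ℂ M m ∈ LinearMap.range (SymmetricAlgebra.ι ℂ M) := ⟨m, rfl⟩

lemma symPower_succ (j : ℕ) :
    symPower M (j + 1) = LinearMap.range (SymmetricAlgebra.ι ℂ M) * symPower M j :=
  pow_succ' _ _

lemma mul_mem_symPower {j k : ℕ} {f g : SymmetricAlgebra ℂ M} (hf : f ∈ symPower M j)
    (hg : g ∈ symPower M k) : f * g ∈ symPower M (j + k) := by
  rw [symPower, pow_add]
  exact Submodule.mul_mem_mul hf hg

lemma mem_symPower_zero {f : SymmetricAlgebra ℂ M} (hf : f ∈ symPower M 0) :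
    f = algebraMap ℂ _ (constantTerm M f) := by
  rw [symPower, pow_zero, Submodule.mem_one] at hf
  obtain ⟨c, rfl⟩ := hf
  rw [AlgHom.commutes, Algebra.algebraMap_self, RingHom.id_apply]

lemma constantTerm_eq_zero {j : ℕ} (hj : j ≠ 0) {f : SymmetricAlgebra ℂ M}
    (hf : f ∈ symPower M j) : constantTerm M f = 0 := by
  obtain ⟨k, rfl⟩ := Nat.exists_eq_succ_of_ne_zero hj
  rw [Nat.succ_eq_add_one, symPower_succ] at hf
  induction hf using Submodule.mul_induction_on' with
  | mem_mul_mem m hm n hn =>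
    obtain ⟨m, rfl⟩ := hm
    rw [map_mul, constantTerm_ι, zero_mul]
  | add x _ y _ hx hy => rw [map_add, hx, hy, add_zero]

lemma weylSym_mem_symPower (w : P.weylGroup) {j : ℕ} {f : SymmetricAlgebra ℂ M}
    (hf : f ∈ symPower M j) : P.weylSym w f ∈ symPower M j := by
  induction j generalizing f with
  | zero =>
    rw [mem_symPower_zero hf, AlgHom.commutes, ← mem_symPower_zero hf]
    exact hf
  | succ j ih =>
    rw [symPower_succ] at hf ⊢
    induction hf using Submodule.mul_induction_on' with
    | mem_mul_mem m hm n hn =>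
      obtain ⟨m, rfl⟩ := hm
      rw [map_mul, weylSym_ι]
      exact Submodule.mul_mem_mul (ι_mem_range _) (ih hn)
    | add x _ y _ hx hy => rw [map_add]; exact add_mem hx hy

lemma demazure_mem_symPower_zero (i : ι) {f : SymmetricAlgebra ℂ M}
    (hf : f ∈ symPower M 0) : P.demazure i f = 0 := by
  apply demazure_of_invariant
  rw [mem_symPower_zero hf, AlgHom.commutes]

lemma demazure_mem_symPower (i : ι) {j : ℕ} {f : SymmetricAlgebra ℂ M}
    (hf : f ∈ symPower M (j + 1)) : P.demazure i f ∈ symPower M j := by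
  induction j generalizing f with
  | zero =>
    rw [symPower, zero_add, pow_one] at hf
    obtain ⟨m, rfl⟩ := hf
    rw [demazure_ι, symPower, pow_zero]
    exact Submodule.algebraMap_mem _
  | succ j ih =>
    rw [symPower_succ] at hf
    induction hf using Submodule.mul_induction_on' with
    | mem_mul_mem m hm n hn =>
      obtain ⟨m, rfl⟩ := hm
      rw [demazure_ι_mul]
      refine add_mem ?_ (Submodule.smul_mem _ _ hn)
      rw [symPower_succ]
      exact Submodule.mul_mem_mul (ι_mem_range _) (ih hn)
    | add x _ y _ hx hy => rw [map_add]; exact add_mem hx hy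

lemma exists_sum_symPower (f : SymmetricAlgebra ℂ M) :
    ∃ (s : Finset ℕ) (g : ℕ → SymmetricAlgebra ℂ M), (∀ j, g j ∈ symPower M j) ∧
      f = ∑ j ∈ s, g j := by
  have h : f ∈ ⨆ j, symPower M j := by
    induction f using SymmetricAlgebra.induction with
    | algebraMap r =>
      refine Submodule.mem_iSup_of_mem 0 ?_
      rw [symPower, pow_zero]
      exact Submodule.algebraMap_mem r
    | ι x =>
      refine Submodule.mem_iSup_of_mem 1 ?_
      rw [symPower, pow_one]
      exact ι_mem_range x
    | mul a c ha hc =>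
      have hmul : (⨆ j, symPower M j) * (⨆ j, symPower M j) ≤ ⨆ j, symPower M j := by
        rw [Submodule.iSup_mul]
        refine iSup_le fun j => ?_
        rw [Submodule.mul_iSup]
        refine iSup_le fun k => ?_
        rw [symPower, symPower, ← pow_add]
        exact le_iSup (symPower M) (j + k)
      exact hmul (Submodule.mul_mem_mul ha hc)
    | add a c ha hc => exact add_mem ha hc
  obtain ⟨g, hg, rfl⟩ := (Submodule.mem_iSup_iff_exists_finsupp _ _).mp h
  exact ⟨g.support, g, hg, rfl⟩

end Operators

namespace Base

variable {P : RootPairing ι ℂ M N} (b : P.Base)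

/-! ### Compositions of Demazure operators along words -/

/-- The composition of the Demazure operators along a word. -/
def demazureWord (l : List b.support) : Module.End ℂ (SymmetricAlgebra ℂ M) :=
  (l.map fun i => (P.demazure i : Module.End ℂ (SymmetricAlgebra ℂ M))).prod

lemma demazureWord_nil (f : SymmetricAlgebra ℂ M) : b.demazureWord [] f = f := rfl

lemma demazureWord_cons (i : b.support) (l : List b.support) (f : SymmetricAlgebra ℂ M) :
    b.demazureWord (i :: l) f = P.demazure i (b.demazureWord l f) := by
  simp [demazureWord]

lemma demazureWord_append (l m : List b.support) (f : SymmetricAlgebra ℂ M) :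
    b.demazureWord (l ++ m) f = b.demazureWord l (b.demazureWord m f) := by
  simp [demazureWord]

lemma demazureWord_mem_symPower (l : List b.support) {j : ℕ} {f : SymmetricAlgebra ℂ M}
    (hf : f ∈ symPower M (l.length + j)) : b.demazureWord l f ∈ symPower M j := by
  induction l generalizing j with
  | nil => simpa [demazureWord_nil] using hf
  | cons i l ih =>
    rw [demazureWord_cons]
    refine P.demazure_mem_symPower i (ih ?_)
    rw [List.length_cons] at hf
    convert hf using 2
    omega

lemma demazureWord_eq_zero_of_lt (l : List b.support) {j : ℕ} {f : SymmetricAlgebra ℂ M}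
    (hf : f ∈ symPower M j) (hj : j < l.length) : b.demazureWord l f = 0 := by
  induction l generalizing j with
  | nil => simp at hj
  | cons i l ih =>
    rw [demazureWord_cons]
    obtain hj' | rfl := Nat.lt_or_eq_of_le (Nat.lt_succ_iff.mp hj)
    · rw [ih hf hj', map_zero]
    · exact P.demazure_mem_symPower_zero i (b.demazureWord_mem_symPower l (j := 0) hf)

lemma constantTerm_demazureWord_eq_zero (l : List b.support) {j : ℕ} {f : SymmetricAlgebra ℂ M}
    (hf : f ∈ symPower M j) (hj : j ≠ l.length) : constantTerm M (b.demazureWord l f) = 0 := by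
  obtain hj | hj := Nat.lt_or_gt_of_ne hj
  · rw [b.demazureWord_eq_zero_of_lt l hf hj, map_zero]
  · refine constantTerm_eq_zero (Nat.sub_ne_zero_of_lt hj) (b.demazureWord_mem_symPower l ?_)
    rwa [Nat.add_sub_cancel' hj.le]

/-- The iterated twisted Leibniz rule: the factor `m` either passes all letters or is consumed by
one of them, and `W`-invariance of the pairing pulls that coroot back through the suffix. -/
lemma demazureWord_ι_mul (l : List b.support) (m : M) (f : SymmetricAlgebra ℂ M) :
    b.demazureWord l (SymmetricAlgebra.ι ℂ M m * f) =
      SymmetricAlgebra.ι ℂ M (b.wordProd l • m) * b.demazureWord l f +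
        ((b.deletions l).map fun p => P.coroot' p.1 m • b.demazureWord p.2 f).sum := by
  induction l with
  | nil => simp [demazureWord_nil, deletions, wordProd_nil]
  | cons i l ih =>
    have h : P.coroot' ((b.wordProd l)⁻¹ • (i : ι)) m = P.coroot' i (b.wordProd l • m) := by
      rw [← P.coroot'_weylGroup_smul (b.wordProd l), smul_inv_smul]
    rw [demazureWord_cons, ih, map_add, demazure_ι_mul, map_list_sum, wordProd_cons, mul_smul,
      demazureWord_cons, add_assoc]
    simp only [deletions, List.map_cons, List.sum_cons, List.map_map, Function.comp_def, h,
      map_smul, demazureWord_cons]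

section Finite

variable [Finite ι] [P.IsCrystallographic] [P.IsReduced]

lemma demazureOp_eq_demazureWord (w : P.weylGroup) :
    ∃ l : List b.support, b.wordProd l = w ∧ l.length = b.length w ∧
      b.demazureOp w = b.demazureWord l :=
  ⟨_, (b.exists_reducedWord w).choose_spec.1, (b.exists_reducedWord w).choose_spec.2, rfl⟩

/-- The composition along a word depends only on its product if the word is reduced, and
vanishes otherwise. -/
lemma demazureWord_eq_aux (n : ℕ) :
    (∀ l m : List b.support, l.length = n → b.IsReducedWord l → b.IsReducedWord m →
      b.wordProd l = b.wordProd m → b.demazureWord l = b.demazureWord m) ∧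
    (∀ l : List b.support, l.length = n → ¬ b.IsReducedWord l → b.demazureWord l = 0) := by
  classical
  induction n with
  | zero =>
    refine ⟨fun l m hl hlr hmr h => ?_, fun l hl hlr => ?_⟩
    · have hm : m.length = 0 := by rw [← hmr, ← h, hlr, hl]
      rw [List.length_eq_zero_iff] at hl hm
      rw [hl, hm]
    · rw [List.length_eq_zero_iff] at hl
      exact absurd (by rw [hl]; exact b.length_one) hlr
  | succ n ih =>
    obtain ⟨ih1, ih2⟩ := ih
    -- The induction hypothesis, in the form that the operator of a word of length `n` depends only
    -- on the product.
    have key (l : List b.support) (hl : l.length = n) : b.demazureWord l =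
        if b.length (b.wordProd l) = n then b.demazureOp (b.wordProd l) else 0 := by
      split_ifs with h
      · obtain ⟨m, hm, hm', hop⟩ := b.demazureOp_eq_demazureWord (b.wordProd l)
        rw [hop]
        refine ih1 l m hl (h.trans hl.symm) ?_ hm.symm
        rw [IsReducedWord, hm, hm']
      · exact ih2 l hl fun hr => h (hr.trans hl)
    have hred (l m : List b.support) (hl : l.length = n + 1) (hlr : b.IsReducedWord l)
        (hmr : b.IsReducedWord m) (h : b.wordProd l = b.wordProd m) :
        b.demazureWord l = b.demazureWord m := by
      have hm : m.length = n + 1 := by rw [← hmr, ← h, hlr, hl]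
      let F (x : M) (f : SymmetricAlgebra ℂ M) (j : ι) : SymmetricAlgebra ℂ M := P.coroot' j x •
        (if b.length (b.wordProd l * weylGroup.ofIdx P j) = n then
          b.demazureOp (b.wordProd l * weylGroup.ofIdx P j) else 0 : Module.End ℂ _) f
      have hsum (k : List b.support) (hk : k.length = n + 1) (hkl : b.wordProd k = b.wordProd l)
          (x : M) (f : SymmetricAlgebra ℂ M) :
          ((b.deletions k).map fun p => P.coroot' p.1 x • b.demazureWord p.2 f).sum =
            (((b.deletions k).map Prod.fst).map (F x f)).sum := by
        rw [List.map_map]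
        congr 1
        refine List.map_congr_left fun p hp => ?_
        have h1 := b.length_of_mem_deletions hp
        rw [key p.2 (by omega), b.wordProd_of_mem_deletions hp, hkl]
        rfl
      -- Both lists enumerate the inversions of the common product, so the correction terms in the
      -- Leibniz expansions agree.
      have hperm : ((b.deletions l).map Prod.fst).Perm ((b.deletions m).map Prod.fst) := by
        obtain ⟨hl1, hl2⟩ := hlr.nodup_and_mem_inversions
        obtain ⟨hm1, hm2⟩ := hmr.nodup_and_mem_inversions
        rw [List.perm_ext_iff_of_nodup hl1 hm1]
        intro j
        rw [hl2, hm2, h]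
      have hι (x : M) (f : SymmetricAlgebra ℂ M) :
          (b.demazureWord l - b.demazureWord m) (SymmetricAlgebra.ι ℂ M x * f) =
            SymmetricAlgebra.ι ℂ M (b.wordProd l • x) *
              (b.demazureWord l - b.demazureWord m) f := by
        rw [LinearMap.sub_apply, LinearMap.sub_apply, demazureWord_ι_mul, demazureWord_ι_mul,
          hsum l hl rfl, hsum m hm h.symm, (hperm.map (F x f)).sum_eq, ← h]
        ring
      -- The difference is linear up to the twist by the product, hence determined by its value at
      -- 1, which is zero for degree reasons.
      have hmul (f g : SymmetricAlgebra ℂ M) :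
          (b.demazureWord l - b.demazureWord m) (f * g) =
            P.weylSym (b.wordProd l) f * (b.demazureWord l - b.demazureWord m) g := by
        induction f using SymmetricAlgebra.induction generalizing g with
        | algebraMap r => rw [AlgHom.commutes, ← Algebra.smul_def, map_smul, Algebra.smul_def]
        | ι x => rw [hι, weylSym_ι]
        | mul a c ha hc => rw [mul_assoc, ha, hc, map_mul, mul_assoc]
        | add a c ha hc => rw [add_mul, map_add, ha, hc, map_add, add_mul]
      have hone : (1 : SymmetricAlgebra ℂ M) ∈ symPower M 0 := by
        rw [symPower, pow_zero]
        exact Submodule.one_le.mp le_rfl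
      rw [← sub_eq_zero]
      ext f
      rw [← mul_one f, hmul, LinearMap.sub_apply,
        b.demazureWord_eq_zero_of_lt l hone (by omega),
        b.demazureWord_eq_zero_of_lt m hone (by omega), sub_zero, mul_zero]
      rfl
    refine ⟨hred, fun l hl hlr => ?_⟩
    obtain ⟨i, k, rfl⟩ := List.exists_cons_of_ne_nil (List.ne_nil_of_length_eq_add_one hl)
    have hk : k.length = n := by simpa using hl
    ext f
    rw [demazureWord_cons]
    by_cases hkr : b.IsReducedWord k
    · have hdesc : b.length (weylGroup.ofIdx P i * b.wordProd k) + 1 =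
          b.length (b.wordProd k) := by
        refine (b.length_ofIdx_mul _ i).resolve_left fun h => hlr ?_
        rw [IsReducedWord, wordProd_cons, h, hkr, List.length_cons]
      -- The tail is reduced but `s_i` shortens it, so it can be rewritten to begin with `i`; then
      -- `Δ_i Δ_i = 0` applies.
      obtain ⟨m, hm, hm'⟩ := b.exists_reducedWord (weylGroup.ofIdx P i * b.wordProd k)
      have hprod : b.wordProd k = b.wordProd (i :: m) := by
        rw [wordProd_cons, hm, ← mul_assoc, ofIdx_mul_self, one_mul]
      have him : b.IsReducedWord (i :: m) := by
        rw [IsReducedWord, ← hprod, ← hdesc, ← hm', List.length_cons]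
      rw [ih1 k (i :: m) hk hkr him hprod, demazureWord_cons, demazure_demazure]
      rfl
    · rw [ih2 k hk hkr, LinearMap.zero_apply, map_zero]

lemma demazureWord_of_not_isReducedWord {l : List b.support} (h : ¬ b.IsReducedWord l) :
    b.demazureWord l = 0 :=
  (b.demazureWord_eq_aux l.length).2 l rfl h

lemma demazureWord_of_isReducedWord {l : List b.support} (h : b.IsReducedWord l) :
    b.demazureWord l = b.demazureOp (b.wordProd l) := by
  obtain ⟨m, hm, hm', hop⟩ := b.demazureOp_eq_demazureWord (b.wordProd l)
  rw [hop]
  refine (b.demazureWord_eq_aux l.length).1 l m rfl h ?_ hm.symm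
  rw [IsReducedWord, hm, hm']

lemma demazureOp_mul {v w : P.weylGroup} (h : b.length (v * w) = b.length v + b.length w)
    (f : SymmetricAlgebra ℂ M) : b.demazureOp (v * w) f = b.demazureOp v (b.demazureOp w f) := by
  obtain ⟨l, hl, hl', hlop⟩ := b.demazureOp_eq_demazureWord v
  obtain ⟨m, hm, hm', hmop⟩ := b.demazureOp_eq_demazureWord w
  have hprod : b.wordProd (l ++ m) = v * w := by rw [wordProd_append, hl, hm]
  rw [hlop, hmop, ← demazureWord_append, ← hprod, ← demazureWord_of_isReducedWord]
  rw [IsReducedWord, hprod, h, List.length_append, hl', hm']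

lemma demazureOp_demazureOp_of_ne {v w : P.weylGroup}
    (h : b.length (v * w) ≠ b.length v + b.length w)
    (f : SymmetricAlgebra ℂ M) : b.demazureOp v (b.demazureOp w f) = 0 := by
  obtain ⟨l, hl, hl', hlop⟩ := b.demazureOp_eq_demazureWord v
  obtain ⟨m, hm, hm', hmop⟩ := b.demazureOp_eq_demazureWord w
  have hprod : b.wordProd (l ++ m) = v * w := by rw [wordProd_append, hl, hm]
  rw [hlop, hmop, ← demazureWord_append, demazureWord_of_not_isReducedWord]
  · rfl
  · rwa [IsReducedWord, hprod, List.length_append, hl', hm']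

lemma demazureOp_ofIdx (i : b.support) (f : SymmetricAlgebra ℂ M) :
    b.demazureOp (weylGroup.ofIdx P i) f = P.demazure i f := by
  have h : b.wordProd [i] = weylGroup.ofIdx P i := by rw [wordProd_cons, wordProd_nil, mul_one]
  rw [← h, ← demazureWord_of_isReducedWord, demazureWord_cons, demazureWord_nil]
  rw [IsReducedWord, h, length_ofIdx, List.length_singleton]

end Finite

end Base

/-! ### Stability of the coinvariant ideal under Demazure operators. -/

section CoinvariantIdeal

variable (P : RootPairing ι ℂ M N)

lemma constantTerm_of_mem_coinvariantIdeal {f : SymmetricAlgebra ℂ M}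
    (hf : f ∈ P.coinvariantIdeal) : constantTerm M f = 0 := by
  suffices h : P.coinvariantIdeal ≤ RingHom.ker (constantTerm M) from h hf
  refine Ideal.span_le.mpr ?_
  rintro g ⟨j, hj, hg, -⟩
  exact constantTerm_eq_zero (by omega) hg

lemma demazure_mem_coinvariantIdeal (i : ι) {f : SymmetricAlgebra ℂ M}
    (hf : f ∈ P.coinvariantIdeal) : P.demazure i f ∈ P.coinvariantIdeal := by
  refine Submodule.span_induction (p := fun f _ => P.demazure i f ∈ P.coinvariantIdeal)
    ?_ ?_ ?_ ?_ hf
  · rintro g ⟨-, -, -, hg⟩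
    rw [P.demazure_of_invariant (hg _)]
    exact zero_mem _
  · rw [map_zero]
    exact zero_mem _
  · intro x y _ _ hx hy
    rw [map_add]
    exact add_mem hx hy
  · intro a x hx hx'
    rw [smul_eq_mul, demazure_mul]
    exact add_mem (Ideal.mul_mem_left _ _ hx) (Ideal.mul_mem_left _ _ hx')

end CoinvariantIdeal

namespace Base

variable {P : RootPairing ι ℂ M N} (b : P.Base)

section Finite

variable [Finite ι] [P.IsCrystallographic] [P.IsReduced]

/-! ### Separation of the coinvariant algebra by Demazure operators -/

lemma sub_weylSym_mem_coinvariantIdeal {f : SymmetricAlgebra ℂ M}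
    (hf : ∀ i : b.support, P.demazure i f ∈ P.coinvariantIdeal) (w : P.weylGroup) :
    f - P.weylSym w f ∈ P.coinvariantIdeal := by
  obtain ⟨l, rfl⟩ := b.exists_wordProd w
  induction l with
  | nil =>
    rw [wordProd_nil, weylSym_one, sub_self]
    exact zero_mem _
  | cons i l ih =>
    have h1 : f - P.weylSym (weylGroup.ofIdx P i) f ∈ P.coinvariantIdeal := by
      rw [← root_mul_demazure]
      exact Ideal.mul_mem_left _ _ (hf i)
    have h2 := add_mem h1 (P.weylSym_mem_coinvariantIdeal (weylGroup.ofIdx P i) ih)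
    rwa [map_sub, sub_add_sub_cancel, ← weylSym_mul, ← wordProd_cons] at h2

/-- Modulo the ideal `f` is `W`-invariant, hence equal to its average over `W`; the average is an
invariant of positive degree and so lies in the ideal. -/
lemma mem_coinvariantIdeal_of_forall_demazure [P.IsRootSystem] {j : ℕ} {f : SymmetricAlgebra ℂ M}
    (hj : 1 ≤ j) (hfj : f ∈ symPower M j)
    (hf : ∀ i : b.support, P.demazure i f ∈ P.coinvariantIdeal) : f ∈ P.coinvariantIdeal := by
  have := P.finite_weylGroup
  have := Fintype.ofFinite P.weylGroup
  have h1 : ∑ w : P.weylGroup, (f - P.weylSym w f) ∈ P.coinvariantIdeal :=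
    sum_mem fun w _ => b.sub_weylSym_mem_coinvariantIdeal hf w
  have h2 : ∑ w : P.weylGroup, P.weylSym w f ∈ P.coinvariantIdeal := by
    refine Ideal.subset_span ⟨j, hj, sum_mem fun w _ => P.weylSym_mem_symPower w hfj, fun v => ?_⟩
    rw [map_sum]
    simp only [← weylSym_mul]
    exact Fintype.sum_equiv (Equiv.mulLeft v) _ _ fun _ => rfl
  have h3 := add_mem h1 h2
  rw [← Finset.sum_add_distrib] at h3
  simp only [sub_add_cancel, Finset.sum_const, Finset.card_univ] at h3
  rw [← Nat.cast_smul_eq_nsmul ℂ] at h3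
  have h4 := Submodule.smul_of_tower_mem P.coinvariantIdeal
    ((Fintype.card P.weylGroup : ℂ)⁻¹) h3
  rwa [smul_smul, inv_mul_cancel₀ (Nat.cast_ne_zero.mpr Fintype.card_ne_zero), one_smul] at h4

/-- A homogeneous element lies in the coinvariant ideal if all compositions of Demazure operators
of the right degree annihilate it. -/
lemma mem_coinvariantIdeal_of_symPower [P.IsRootSystem] {j : ℕ} {f : SymmetricAlgebra ℂ M}
    (hfj : f ∈ symPower M j)
    (hf : ∀ l : List b.support, l.length = j → constantTerm M (b.demazureWord l f) = 0) :
    f ∈ P.coinvariantIdeal := by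
  induction j generalizing f with
  | zero =>
    have := hf [] rfl
    rw [demazureWord_nil] at this
    rw [mem_symPower_zero hfj, this, map_zero]
    exact zero_mem _
  | succ j ih =>
    refine b.mem_coinvariantIdeal_of_forall_demazure (Nat.le_add_left 1 j) hfj fun i => ?_
    refine ih (P.demazure_mem_symPower i hfj) fun l hl => ?_
    have := hf (l ++ [i]) (by rw [List.length_append, hl, List.length_singleton])
    rwa [demazureWord_append, demazureWord_cons, demazureWord_nil] at this

/-- The constant term after a word of length `j` sees only the component of degree `j`, which
reduces the claim to homogeneous elements. -/
lemma mem_coinvariantIdeal_of_forall_demazureOp [P.IsRootSystem] {f : SymmetricAlgebra ℂ M}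
    (hf : ∀ w : P.weylGroup, constantTerm M (b.demazureOp w f) = 0) :
    f ∈ P.coinvariantIdeal := by
  obtain ⟨s, g, hg, rfl⟩ := exists_sum_symPower f
  refine sum_mem fun j hj => b.mem_coinvariantIdeal_of_symPower (hg j) fun l hl => ?_
  by_cases hlr : b.IsReducedWord l
  · have h := hf (b.wordProd l)
    rw [← demazureWord_of_isReducedWord b hlr, map_sum, map_sum, Finset.sum_eq_single j] at h
    · exact h
    · exact fun k _ hk => b.constantTerm_demazureWord_eq_zero l (hg k) (by omega)
    · exact fun h' => absurd hj h'
  · rw [demazureWord_of_not_isReducedWord b hlr, LinearMap.zero_apply, map_zero]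

/-! ### Nonvanishing of the Demazure operators -/

/-- Both notions are reversed by negation, hold on simple indices, and survive a simple reflection
away from its own root. This is what makes a weight positive on simple coroots positive on the
coroots of all positive roots. -/
lemma isPos_flip_iff (j : ι) : b.flip.IsPos j ↔ b.IsPos j := by
  have hneg (k : ι) : b.flip.IsPos (P.reflectionPerm k k) ↔ ¬ b.flip.IsPos k :=
    IsPos.neg_iff_not b.flip k
  have hrefl (i k : ι) (hi : i ∈ b.support) (hk : b.IsPos k) (hk' : b.flip.IsPos k) :
      b.flip.IsPos (P.reflectionPerm i k) ↔ b.IsPos (P.reflectionPerm i k) := by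
    by_cases hik : k = i
    · subst hik
      rw [hneg, isPos_neg_index_iff]
      tauto
    · exact iff_of_true (IsPos.reflectionPerm (b := b.flip) hk' hi hik) (hk.reflectionPerm hi hik)
  refine b.induction_reflect j (p := fun j => b.flip.IsPos j ↔ b.IsPos j) ?_ ?_ ?_
  · intro i hi
    rw [hneg, isPos_neg_index_iff, hi]
  · exact fun i hi => iff_of_true (b.flip.isPos_of_mem_support hi) (b.isPos_of_mem_support hi)
  · intro k i hk hi
    by_cases hpos : b.IsPos k
    · exact hrefl i k hi hpos (hk.mpr hpos)
    · have h := hrefl i (P.reflectionPerm k k) hi ((b.isPos_neg_index_iff k).mpr hpos)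
        ((hneg k).mpr (hk.not.mpr hpos))
      have h2 : P.reflectionPerm i (P.reflectionPerm k k) =
          P.reflectionPerm (P.reflectionPerm i k) (P.reflectionPerm i k) :=
        P.weylGroup_smul_neg_index (weylGroup.ofIdx P i) k
      rw [h2, hneg, isPos_neg_index_iff, not_iff_not] at h
      exact h

/-- There is a strictly dominant weight. -/
lemma exists_dominant [P.IsRootSystem] :
    ∃ m : M, ∀ j, b.IsPos j → ∃ n : ℕ, 0 < n ∧ P.coroot' j m = n := by
  classical
  -- The weight takes the value 1 on each simple coroot, so its value on any coroot is the height of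
  -- that coroot.
  let φ : Module.Dual ℂ N := b.toCoweightBasis.constr ℂ fun _ => (1 : ℂ)
  refine ⟨P.toPerfPair.symm φ, fun j hj => ?_⟩
  have h1 (n : N) : P.toLinearMap (P.toPerfPair.symm φ) n = φ n :=
    LinearMap.congr_fun (LinearMap.apply_symm_toPerfPair_self (p := P.toLinearMap) φ) n
  obtain ⟨f, -, -, hf⟩ := b.flip.exists_root_eq_sum_int j
  have hpos := (b.isPos_flip_iff j).mpr hj
  rw [isPos_iff, height_eq_sum hf] at hpos
  replace hpos : 0 < ∑ k ∈ b.support, f k := hpos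
  refine ⟨(∑ k ∈ b.support, f k).toNat, by simpa using hpos, ?_⟩
  have h2 : P.coroot j = ∑ k ∈ b.support, f k • P.coroot k := hf
  have h3 (k : ι) (hk : k ∈ b.support) : φ (P.coroot k) = 1 := by
    have := b.toCoweightBasis.constr_basis ℂ (fun _ => (1 : ℂ)) ⟨k, hk⟩
    rwa [toCoweightBasis_apply] at this
  change P.toLinearMap (P.toPerfPair.symm φ) (P.coroot j) = _
  rw [h1, h2, map_sum]
  have h4 : (((∑ k ∈ b.support, f k).toNat : ℕ) : ℂ) = ((∑ k ∈ b.support, f k : ℤ) : ℂ) := by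
    rw [← Int.cast_natCast, Int.toNat_of_nonneg (le_of_lt hpos)]
  rw [h4, Int.cast_sum]
  refine Finset.sum_congr rfl fun k hk => ?_
  rw [map_zsmul, h3 k hk, zsmul_eq_mul, mul_one]

/-- In the Leibniz expansion a deletion contributes a positive integer if it is reduced and zero
otherwise. Deleting the first letter leaves a reduced word, so the sum is positive. -/
lemma exists_constantTerm_demazureWord_pow {m : M}
    (hm : ∀ j, b.IsPos j → ∃ n : ℕ, 0 < n ∧ P.coroot' j m = n) (l : List b.support)
    (hl : b.IsReducedWord l) :
    ∃ n : ℕ, 0 < n ∧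
      constantTerm M (b.demazureWord l (SymmetricAlgebra.ι ℂ M m ^ l.length)) = n := by
  induction hn : l.length generalizing l with
  | zero =>
    rw [List.length_eq_zero_iff] at hn
    subst hn
    exact ⟨1, one_pos, by rw [demazureWord_nil, pow_zero, map_one, Nat.cast_one]⟩
  | succ k ih =>
    obtain ⟨i, l, rfl⟩ := List.exists_cons_of_ne_nil (List.ne_nil_of_length_eq_add_one hn)
    have hterm (p : ι × List b.support) (hp : p ∈ b.deletions (i :: l)) :
        ∃ n : ℕ, constantTerm M (P.coroot' p.1 m •
          b.demazureWord p.2 (SymmetricAlgebra.ι ℂ M m ^ k)) = n ∧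
            (b.IsReducedWord p.2 → 0 < n) := by
      have hlen := b.length_of_mem_deletions hp
      by_cases hpr : b.IsReducedWord p.2
      · have hpos : b.IsPos p.1 :=
          ((hl.nodup_and_mem_inversions.2 _).mp (List.mem_map_of_mem hp)).1
        obtain ⟨n, hn0, hn'⟩ := hm p.1 hpos
        obtain ⟨n', hn0', hn''⟩ := ih p.2 hpr (by omega)
        exact ⟨n * n', by rw [map_smul, hn', hn'', smul_eq_mul, Nat.cast_mul],
          fun _ => Nat.mul_pos hn0 hn0'⟩
      · refine ⟨0, ?_, fun h => absurd h hpr⟩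
        rw [b.demazureWord_of_not_isReducedWord hpr, LinearMap.zero_apply, smul_zero, map_zero,
          Nat.cast_zero]
    have hsum (L : List (ι × List b.support)) (hL : ∀ p ∈ L, p ∈ b.deletions (i :: l)) :
        ∃ n : ℕ, constantTerm M ((L.map fun p => P.coroot' p.1 m •
          b.demazureWord p.2 (SymmetricAlgebra.ι ℂ M m ^ k)).sum) = n := by
      induction L with
      | nil => exact ⟨0, by simp⟩
      | cons p L ihL =>
        obtain ⟨n, hn⟩ := ihL fun q hq => hL q (List.mem_cons_of_mem _ hq)
        obtain ⟨n', hn', -⟩ := hterm p (hL p List.mem_cons_self)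
        exact ⟨n' + n, by rw [List.map_cons, List.sum_cons, map_add, hn, hn', Nat.cast_add]⟩
    obtain ⟨n, hn1, hn2⟩ := hterm ((b.wordProd l)⁻¹ • (i : ι), l) List.mem_cons_self
    obtain ⟨n', hn'⟩ := hsum ((b.deletions l).map fun p => (p.1, i :: p.2))
      fun p hp => List.mem_cons_of_mem _ hp
    refine ⟨n + n', Nat.add_pos_left (hn2 hl.of_cons) _, ?_⟩
    rw [pow_succ', demazureWord_ι_mul, map_add, map_mul, constantTerm_ι, zero_mul, zero_add,
      deletions, List.map_cons, List.sum_cons, map_add, hn1, hn', Nat.cast_add]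

lemma demazureOp_ne_zero [P.IsRootSystem] (w : P.weylGroup) : b.demazureOp w ≠ 0 := by
  obtain ⟨m, hm⟩ := b.exists_dominant
  obtain ⟨l, rfl, hl⟩ := b.exists_reducedWord w
  obtain ⟨n, hn, h⟩ := b.exists_constantTerm_demazureWord_pow hm l hl.symm
  rw [← b.demazureWord_of_isReducedWord hl.symm]
  intro h0
  rw [h0, LinearMap.zero_apply, map_zero] at h
  exact hn.ne' (by exact_mod_cast h.symm)

end Finite

end Base

/-! ### Roots as prime elements of the symmetric algebra. -/

section Prime

lemma symι_injective : Function.Injective (SymmetricAlgebra.ι ℂ M) := by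
  rw [injective_iff_map_eq_zero]
  intro m hm
  rw [← Module.forall_dual_apply_eq_zero_iff ℂ]
  intro c
  rw [← SymmetricAlgebra.lift_ι_apply (f := c) m, hm, map_zero]

/-- The endomorphism of the symmetric algebra which projects the generators along `m`. -/
def symProjection (c : Module.Dual ℂ M) (m : M) :
    SymmetricAlgebra ℂ M →ₐ[ℂ] SymmetricAlgebra ℂ M :=
  SymmetricAlgebra.lift (SymmetricAlgebra.ι ℂ M ∘ₗ (LinearMap.id - c.smulRight m))

lemma symProjection_ι (c : Module.Dual ℂ M) (m n : M) :
    symProjection c m (SymmetricAlgebra.ι ℂ M n) = SymmetricAlgebra.ι ℂ M (n - c n • m) := by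
  rw [symProjection, SymmetricAlgebra.lift_ι_apply]
  rfl

lemma symι_dvd_sub_symProjection (c : Module.Dual ℂ M) (m : M) (f : SymmetricAlgebra ℂ M) :
    SymmetricAlgebra.ι ℂ M m ∣ f - symProjection c m f := by
  induction f using SymmetricAlgebra.induction with
  | algebraMap r => simp
  | ι n =>
    rw [symProjection_ι, ← map_sub, sub_sub_cancel, map_smul, Algebra.smul_def]
    exact dvd_mul_left _ _
  | mul f g hf hg =>
    have h : f * g - symProjection c m (f * g) =
        (f - symProjection c m f) * g + symProjection c m f * (g - symProjection c m g) := by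
      rw [map_mul]; ring
    rw [h]
    exact dvd_add (hf.mul_right _) (hg.mul_left _)
  | add f g hf hg =>
    rw [map_add, add_sub_add_comm]
    exact dvd_add hf hg

/-- Identifies the ideal of multiples of `m` as the kernel of an algebra map into a domain, whence
`prime_symι`. -/
lemma symι_dvd_iff {c : Module.Dual ℂ M} {m : M} (h : c m = 1) (f : SymmetricAlgebra ℂ M) :
    SymmetricAlgebra.ι ℂ M m ∣ f ↔ symProjection c m f = 0 := by
  constructor
  · rintro ⟨g, rfl⟩
    rw [map_mul, symProjection_ι, h, one_smul, sub_self, map_zero, zero_mul]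
  · intro hf
    simpa [hf] using symι_dvd_sub_symProjection c m f

lemma prime_symι {c : Module.Dual ℂ M} {m : M} (h : c m = 1) :
    Prime (SymmetricAlgebra.ι ℂ M m) := by
  refine ⟨fun h0 => ?_, fun hu => ?_, fun f g hfg => ?_⟩
  · rw [symι_injective (h0.trans (map_zero _).symm), map_zero] at h
    exact zero_ne_one h
  · have h1 := (symι_dvd_iff h 1).mp hu.dvd
    rw [map_one] at h1
    exact one_ne_zero h1
  · rw [symι_dvd_iff h, map_mul, mul_eq_zero] at hfg
    rwa [symι_dvd_iff h, symι_dvd_iff h]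

variable (P : RootPairing ι ℂ M N)

lemma half_coroot'_root (i : ι) : ((2 : ℂ)⁻¹ • P.coroot' i) (P.root i) = 1 := by
  simp

lemma prime_symι_root (i : ι) : Prime (SymmetricAlgebra.ι ℂ M (P.root i)) :=
  prime_symι (P.half_coroot'_root i)

lemma eq_or_eq_neg_of_symι_root_dvd [P.IsReduced] {i j : ι}
    (h : SymmetricAlgebra.ι ℂ M (P.root i) ∣ SymmetricAlgebra.ι ℂ M (P.root j)) :
    j = i ∨ j = P.reflectionPerm i i := by
  rw [symι_dvd_iff (P.half_coroot'_root i), symProjection_ι] at h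
  have h1 := symι_injective (h.trans (map_zero _).symm)
  have h2 : ¬ LinearIndependent ℂ ![P.root i, P.root j] := fun hli => by
    rw [LinearIndependent.pair_iff] at hli
    have := hli (-((2 : ℂ)⁻¹ • P.coroot' i) (P.root j)) 1
      (by rw [neg_smul, one_smul, add_comm, ← sub_eq_add_neg]; exact h1)
    exact one_ne_zero this.2
  by_cases hij : i = j
  · exact Or.inl hij.symm
  · have h3 := IsReduced.eq_or_eq_neg i j h2
    rcases h3 with h3 | h3
    · exact absurd (P.root.injective h3) hij
    · right
      apply P.root.injective
      rw [root_neg_index, h3, neg_neg]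

end Prime

namespace Base

variable {P : RootPairing ι ℂ M N} (b : P.Base)

/-! ### The product of the positive roots and antisymmetric elements. -/

section Finite

variable [Finite ι] [P.IsCrystallographic] [P.IsReduced]

lemma prod_root_dvd_of_forall_dvd {f : SymmetricAlgebra ℂ M} (s : Finset ι)
    (hs : ∀ i ∈ s, b.IsPos i) (hf : ∀ i ∈ s, SymmetricAlgebra.ι ℂ M (P.root i) ∣ f) :
    ∏ i ∈ s, SymmetricAlgebra.ι ℂ M (P.root i) ∣ f := by
  classical
  induction s using Finset.induction_on with
  | empty => simp
  | insert i s hi ih =>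
    obtain ⟨g, rfl⟩ := ih (fun j hj => hs j (Finset.mem_insert_of_mem hj))
      (fun j hj => hf j (Finset.mem_insert_of_mem hj))
    rw [Finset.prod_insert hi, mul_comm]
    refine mul_dvd_mul_left _ (((P.prime_symι_root i).dvd_or_dvd
      (hf i (Finset.mem_insert_self i s))).resolve_left fun h => ?_)
    obtain ⟨j, hj, hij⟩ := (P.prime_symι_root i).exists_mem_finset_dvd h
    obtain rfl | rfl := P.eq_or_eq_neg_of_symι_root_dvd hij
    · exact hi hj
    · exact (b.isPos_neg_index_iff i).mp (hs _ (Finset.mem_insert_of_mem hj))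
        (hs i (Finset.mem_insert_self i s))

/-- For a simple root, `f - s f = 2 f` is divisible; simple reflections carry this to all positive
roots, as they change `f` only by a sign. -/
lemma symι_root_dvd_of_antisymmetric {f : SymmetricAlgebra ℂ M}
    (hf : ∀ i : b.support, P.weylSym (weylGroup.ofIdx P i) f = -f) {j : ι} (hj : b.IsPos j) :
    SymmetricAlgebra.ι ℂ M (P.root j) ∣ f := by
  refine hj.induction_on_reflect (p := fun j => SymmetricAlgebra.ι ℂ M (P.root j) ∣ f) ?_ ?_
  · intro i hi
    have h := P.root_dvd_sub_weylSym i f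
    rw [hf ⟨i, hi⟩, sub_neg_eq_add, ← two_smul ℂ f] at h
    have h2 := h.mul_left (algebraMap ℂ _ 2⁻¹)
    rwa [← Algebra.smul_def, smul_smul, inv_mul_cancel₀ two_ne_zero, one_smul] at h2
  · intro i k hi hk
    have h := map_dvd (P.weylSym (weylGroup.ofIdx P k)) hi
    rwa [weylSym_root, hf ⟨k, hk⟩, dvd_neg] at h

variable (P) in
/-- The finite set of positive roots. -/
def positiveRoots (b : P.Base) : Finset ι := (Set.toFinite {j | b.IsPos j}).toFinset

lemma mem_positiveRoots {j : ι} : j ∈ positiveRoots P b ↔ b.IsPos j := by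
  simp [positiveRoots]

/-- The product of the positive roots. -/
def rootProduct : SymmetricAlgebra ℂ M :=
  ∏ j ∈ positiveRoots P b, SymmetricAlgebra.ι ℂ M (P.root j)

lemma rootProduct_ne_zero : b.rootProduct ≠ 0 :=
  Finset.prod_ne_zero_iff.mpr fun j _ => P.symι_root_ne_zero j

lemma weylSym_ofIdx_rootProduct (i : b.support) :
    P.weylSym (weylGroup.ofIdx P i) b.rootProduct = -b.rootProduct := by
  classical
  have hi := (b.mem_positiveRoots).mpr (b.isPos_of_mem_support i.2)
  have hmem (j : ι) (hj : j ∈ (positiveRoots P b).erase i) :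
      weylGroup.ofIdx P (i : ι) • j ∈ (positiveRoots P b).erase i := by
    rw [Finset.mem_erase, mem_positiveRoots] at hj ⊢
    refine ⟨fun h => ?_, hj.2.reflectionPerm i.2 hj.1⟩
    have h2 : j = P.reflectionPerm i i := by
      rw [← ofIdx_smul_index, ← inv_smul_eq_iff, ofIdx_inv]
      exact h
    have h3 := hj.2
    rw [h2, isPos_neg_index_iff] at h3
    exact h3 (b.isPos_of_mem_support i.2)
  rw [rootProduct, ← Finset.mul_prod_erase _ _ hi, map_mul, weylSym_ofIdx_root, map_prod, neg_mul]
  congr 2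
  simp only [weylSym_root]
  refine Finset.prod_nbij' (fun j => weylGroup.ofIdx P (i : ι) • j)
    (fun j => weylGroup.ofIdx P (i : ι) • j) hmem hmem ?_ ?_ fun _ _ => rfl
  all_goals
    intro j _
    rw [← mul_smul, ofIdx_mul_self, one_smul]

lemma rootProduct_mem_symPower [P.IsRootSystem] :
    b.rootProduct ∈ symPower M (b.length b.longestElement) := by
  classical
  have h (s : Finset ι) : ∏ j ∈ s, SymmetricAlgebra.ι ℂ M (P.root j) ∈ symPower M s.card := by
    induction s using Finset.induction_on with
    | empty =>
      rw [Finset.prod_empty, Finset.card_empty, symPower, pow_zero]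
      exact Submodule.one_le.mp le_rfl
    | insert i s hi ih =>
      rw [Finset.prod_insert hi, Finset.card_insert_of_notMem hi, symPower_succ]
      exact Submodule.mul_mem_mul (ι_mem_range _) ih
  rw [length_longestElement, Set.ncard_eq_toFinset_card _]
  exact h _

lemma demazureWord_mul_of_invariant {f g : SymmetricAlgebra ℂ M}
    (hg : ∀ i : b.support, P.weylSym (weylGroup.ofIdx P i) g = g) (l : List b.support) :
    b.demazureWord l (f * g) = b.demazureWord l f * g := by
  induction l with
  | nil => rfl
  | cons i l ih =>
    rw [demazureWord_cons, ih, demazure_mul, P.demazure_of_invariant (hg i), mul_zero, add_zero,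
      demazureWord_cons]

section Longest

variable [P.IsRootSystem]

/-- For each simple `s`, `Δ_{w₀} = Δ_{w₀ s} Δ_s` and `Δ_s (s g) = -Δ_s g`. -/
lemma demazureOp_longestElement_weylSym (w : P.weylGroup) (f : SymmetricAlgebra ℂ M) :
    b.demazureOp b.longestElement (P.weylSym w f) =
      (-1 : ℂ) ^ b.length w • b.demazureOp b.longestElement f := by
  have hstep (i : b.support) (g : SymmetricAlgebra ℂ M) :
      b.demazureOp b.longestElement (P.weylSym (weylGroup.ofIdx P i) g) =
        -b.demazureOp b.longestElement g := by
    have hi := b.isPos_of_mem_support i.2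
    have h1 := b.length_mul_ofIdx_lt (b.not_isPos_longestElement_smul hi)
    have h2 : b.longestElement = b.longestElement * weylGroup.ofIdx P i * weylGroup.ofIdx P i := by
      rw [mul_assoc, ofIdx_mul_self, mul_one]
    have h3 : P.demazure i (P.weylSym (weylGroup.ofIdx P i) g) = -P.demazure i g := by
      apply demazure_unique
      rw [weylSym_ofIdx_ofIdx, mul_neg, root_mul_demazure, neg_sub]
    have h4 (g : SymmetricAlgebra ℂ M) : b.demazureOp b.longestElement g =
        b.demazureOp (b.longestElement * weylGroup.ofIdx P i) (P.demazure i g) := by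
      conv_lhs => rw [h2]
      rw [b.demazureOp_mul (by rw [← h2, length_ofIdx, h1]), demazureOp_ofIdx]
    rw [h4, h3, map_neg, ← h4]
  obtain ⟨l, rfl⟩ := b.exists_wordProd w
  induction l with
  | nil => rw [wordProd_nil, weylSym_one, length_one, pow_zero, one_smul]
  | cons i l ih =>
    rw [wordProd_cons, weylSym_mul, hstep, ih, ← neg_smul]
    congr 1
    obtain h | h := b.length_ofIdx_mul (b.wordProd l) i
    · rw [h, pow_succ, mul_neg_one]
    · rw [← h, pow_succ, mul_neg_one, neg_neg]

lemma demazureOp_longestElement_rootProduct_ne_zero :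
    b.demazureOp b.longestElement b.rootProduct ≠ 0 := by
  have := P.finite_weylGroup
  have := Fintype.ofFinite P.weylGroup
  intro h0
  refine b.demazureOp_ne_zero b.longestElement ?_
  ext f
  -- The antisymmetrization of `f` is an invariant multiple of the root product, so `h0` makes
  -- `Δ_{w₀}` kill it; yet `Δ_{w₀}` sends it to `|W| Δ_{w₀} f`.
  set F : SymmetricAlgebra ℂ M := ∑ w : P.weylGroup, (-1 : ℂ) ^ b.length w • P.weylSym w f with hF
  have hanti (i : b.support) : P.weylSym (weylGroup.ofIdx P i) F = -F := by
    rw [hF, map_sum, ← Finset.sum_neg_distrib]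
    refine Fintype.sum_equiv (Equiv.mulLeft (weylGroup.ofIdx P (i : ι))) _ _ fun w => ?_
    rw [map_smul, ← weylSym_mul, Equiv.coe_mulLeft, ← neg_smul]
    congr 1
    obtain h | h := b.length_ofIdx_mul w i
    · rw [h, pow_succ, mul_neg_one, neg_neg]
    · rw [← h, pow_succ, mul_neg_one]
  obtain ⟨g, hg⟩ : b.rootProduct ∣ F :=
    b.prod_root_dvd_of_forall_dvd _ (fun j hj => b.mem_positiveRoots.mp hj)
      fun j hj => b.symι_root_dvd_of_antisymmetric hanti (b.mem_positiveRoots.mp hj)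
  have hginv (i : b.support) : P.weylSym (weylGroup.ofIdx P i) g = g := by
    have h := hanti i
    rw [hg, map_mul, weylSym_ofIdx_rootProduct, neg_mul, neg_inj] at h
    exact mul_left_cancel₀ b.rootProduct_ne_zero h
  have h1 : b.demazureOp b.longestElement F = 0 := by
    obtain ⟨l, -, -, hl⟩ := b.demazureOp_eq_demazureWord b.longestElement
    rw [hl] at h0 ⊢
    rw [hg, demazureWord_mul_of_invariant b hginv, h0, zero_mul]
  rw [hF, map_sum] at h1
  simp only [map_smul, demazureOp_longestElement_weylSym, smul_smul, ← pow_add, ← two_mul,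
    pow_mul, neg_one_sq, one_pow, one_smul, Finset.sum_const, Finset.card_univ] at h1
  rw [← Nat.cast_smul_eq_nsmul ℂ] at h1
  exact (smul_eq_zero.mp h1).resolve_left (Nat.cast_ne_zero.mpr Fintype.card_ne_zero)

lemma topElement_eq :
    b.topElement = (Nat.card P.weylGroup : ℂ)⁻¹ • b.rootProduct := by
  rw [topElement, rootProduct, positiveRoots, ← finprod_mem_eq_finite_toFinset_prod]
  rfl

lemma topElement_mem_symPower : b.topElement ∈ symPower M (b.length b.longestElement) := by
  rw [topElement_eq]
  exact Submodule.smul_mem _ _ b.rootProduct_mem_symPower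

lemma demazureOp_mem_symPower (w : P.weylGroup) {j : ℕ} {f : SymmetricAlgebra ℂ M}
    (hf : f ∈ symPower M (b.length w + j)) : b.demazureOp w f ∈ symPower M j := by
  obtain ⟨l, -, hl, hop⟩ := b.demazureOp_eq_demazureWord w
  rw [hop]
  exact b.demazureWord_mem_symPower l (by rwa [hl])

lemma constantTerm_demazureOp_eq_zero (w : P.weylGroup) {j : ℕ} {f : SymmetricAlgebra ℂ M}
    (hf : f ∈ symPower M j) (hj : j ≠ b.length w) : constantTerm M (b.demazureOp w f) = 0 := by
  obtain ⟨l, -, hl, hop⟩ := b.demazureOp_eq_demazureWord w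
  rw [hop]
  exact b.constantTerm_demazureWord_eq_zero l hf (by rwa [hl])

/-- The scalar `Δ_{w₀} D`. -/
def topConstant : ℂ := constantTerm M (b.demazureOp b.longestElement b.topElement)

/-- The element `Δ_{w₀} D` has degree 0, so it equals its constant term. Its exact value is never
needed: `parabolicTrace` divides by it. -/
lemma topConstant_ne_zero : b.topConstant ≠ 0 := by
  have := P.finite_weylGroup
  intro h
  have h1 := b.demazureOp_mem_symPower b.longestElement (j := 0) b.topElement_mem_symPower
  have h2 := mem_symPower_zero h1
  rw [← topConstant, h, map_zero, topElement_eq, map_smul, smul_eq_zero] at h2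
  refine h2.elim (fun h3 => ?_) b.demazureOp_longestElement_rootProduct_ne_zero
  rw [inv_eq_zero] at h3
  exact Nat.card_pos.ne' (Nat.cast_eq_zero.mp h3)

end Longest

end Finite

end Base

section Coinvariant

variable (P : RootPairing ι ℂ M N)

/-! ### Operators on the coinvariant algebra -/

lemma exists_toCoinvariant (x : P.CoinvariantAlgebra) : ∃ f, P.toCoinvariant f = x :=
  Ideal.Quotient.mkₐ_surjective ℂ P.coinvariantIdeal x

lemma toCoinvariant_eq_zero_iff {f : SymmetricAlgebra ℂ M} :
    P.toCoinvariant f = 0 ↔ f ∈ P.coinvariantIdeal :=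
  Ideal.Quotient.eq_zero_iff_mem

lemma weylCoinvariant_one (x : P.CoinvariantAlgebra) : P.weylCoinvariant 1 x = x := by
  obtain ⟨f, rfl⟩ := P.exists_toCoinvariant x
  rw [weylCoinvariant_toCoinvariant, weylSym_one]

lemma weylCoinvariant_mul (v w : P.weylGroup) (x : P.CoinvariantAlgebra) :
    P.weylCoinvariant (v * w) x = P.weylCoinvariant v (P.weylCoinvariant w x) := by
  obtain ⟨f, rfl⟩ := P.exists_toCoinvariant x
  simp only [weylCoinvariant_toCoinvariant, weylSym_mul]

/-- The endomorphism of the coinvariant algebra induced by an endomorphism of the symmetric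
algebra which preserves the coinvariant ideal. -/
def coinvariantMap (T : Module.End ℂ (SymmetricAlgebra ℂ M))
    (hT : ∀ f ∈ P.coinvariantIdeal, T f ∈ P.coinvariantIdeal) :
    P.CoinvariantAlgebra →ₗ[ℂ] P.CoinvariantAlgebra :=
  Submodule.mapQ (P.coinvariantIdeal.restrictScalars ℂ) (P.coinvariantIdeal.restrictScalars ℂ) T hT

/-- The Demazure operator of a root on the coinvariant algebra. -/
def coinvariantDemazure (i : ι) : P.CoinvariantAlgebra →ₗ[ℂ] P.CoinvariantAlgebra :=
  P.coinvariantMap (P.demazure i) fun _ => P.demazure_mem_coinvariantIdeal i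

lemma coinvariantDemazure_toCoinvariant (i : ι) (f : SymmetricAlgebra ℂ M) :
    P.coinvariantDemazure i (P.toCoinvariant f) = P.toCoinvariant (P.demazure i f) := rfl

lemma coinvariantDemazure_mul (i : ι) (x y : P.CoinvariantAlgebra) :
    P.coinvariantDemazure i (x * y) = P.coinvariantDemazure i x * y +
      P.weylCoinvariant (weylGroup.ofIdx P i) x * P.coinvariantDemazure i y := by
  obtain ⟨f, rfl⟩ := P.exists_toCoinvariant x
  obtain ⟨g, rfl⟩ := P.exists_toCoinvariant y
  simp only [← map_mul, coinvariantDemazure_toCoinvariant, weylCoinvariant_toCoinvariant,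
    demazure_mul, map_add]

/-- A representative need only be invariant modulo the ideal; averaging it with its reflection gives
a truly invariant one. -/
lemma coinvariantDemazure_of_invariant {i : ι} {x : P.CoinvariantAlgebra}
    (h : P.weylCoinvariant (weylGroup.ofIdx P i) x = x) : P.coinvariantDemazure i x = 0 := by
  obtain ⟨f, rfl⟩ := P.exists_toCoinvariant x
  rw [weylCoinvariant_toCoinvariant] at h
  have h1 : P.toCoinvariant f = (2 : ℂ)⁻¹ •
      P.toCoinvariant (f + P.weylSym (weylGroup.ofIdx P i) f) := by
    rw [map_add, h, ← two_smul ℂ, smul_smul, inv_mul_cancel₀ two_ne_zero, one_smul]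
  rw [h1, map_smul, coinvariantDemazure_toCoinvariant, P.demazure_of_invariant, map_zero, smul_zero]
  rw [map_add, weylSym_ofIdx_ofIdx, add_comm]

lemma weylCoinvariant_coinvariantDemazure (i : ι) (x : P.CoinvariantAlgebra) :
    P.weylCoinvariant (weylGroup.ofIdx P i) (P.coinvariantDemazure i x) =
      P.coinvariantDemazure i x := by
  obtain ⟨f, rfl⟩ := P.exists_toCoinvariant x
  rw [coinvariantDemazure_toCoinvariant, weylCoinvariant_toCoinvariant, weylSym_demazure]

/-- The constant term of an element of the coinvariant algebra. -/
def coinvariantConstantTerm : P.CoinvariantAlgebra →ₐ[ℂ] ℂ :=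
  Ideal.Quotient.liftₐ P.coinvariantIdeal (constantTerm M) fun _ hf =>
    P.constantTerm_of_mem_coinvariantIdeal hf

end Coinvariant

namespace Base

variable {P : RootPairing ι ℂ M N} (b : P.Base)

lemma mem_parabolicInvariants_iff {J : Set b.support} {x : P.CoinvariantAlgebra} :
    x ∈ b.parabolicInvariants J ↔
      ∀ i ∈ J, P.weylCoinvariant (weylGroup.ofIdx P i) x = x := by
  refine ⟨fun h i hi => h _ (Subgroup.subset_closure ⟨i, hi, rfl⟩), fun h w hw => ?_⟩
  induction hw using Subgroup.closure_induction with
  | mem w hw =>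
    obtain ⟨i, hi, rfl⟩ := hw
    exact h i hi
  | one => exact P.weylCoinvariant_one x
  | mul v w _ _ hv hw => rw [weylCoinvariant_mul, hw, hv]
  | inv w _ hw =>
    conv_lhs => rw [← hw]
    rw [← weylCoinvariant_mul, inv_mul_cancel, weylCoinvariant_one]

section Finite

variable [Finite ι] [P.IsCrystallographic] [P.IsReduced]

/-! ### Minimal coset representatives -/

/-- Reduce the concatenation of reduced words of `d` and `u` to a reduced sublist. Minimality of `d`
in its coset forbids deleting letters from the first half, and the second half already has the
fewest letters possible. -/
lemma length_mul_of_mem_minCosetReps {J : Set b.support} {d u : P.weylGroup}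
    (hd : d ∈ b.minCosetReps J) (hu : u ∈ b.parabolic J) :
    b.length (d * u) = b.length d + b.length u := by
  obtain ⟨l, hl, hl'⟩ := b.exists_reducedWord d
  obtain ⟨k, hkJ, hk, hk'⟩ := b.exists_isReducedWord_of_mem_parabolic hu
  obtain ⟨m, hm1, hm2, hm3⟩ := b.exists_isReducedWord_sublist (l ++ k)
  obtain ⟨m₁, m₂, rfl, h1, h2⟩ := List.sublist_append_iff.mp hm1
  have hm₂ : b.wordProd m₂ ∈ b.parabolic J := by
    refine Subgroup.list_prod_mem _ fun w hw => ?_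
    obtain ⟨i, hi, rfl⟩ := List.mem_map.mp hw
    exact Subgroup.subset_closure ⟨i, hkJ i (h2.subset hi), rfl⟩
  rw [wordProd_append, wordProd_append, hl, hk] at hm2
  have h3 := hd (u * (b.wordProd m₂)⁻¹) (mul_mem hu (inv_mem hm₂))
  rw [← mul_assoc, ← hm2, mul_inv_cancel_right] at h3
  have h4 := h3.trans (b.length_wordProd_le m₁)
  have h5 : m₁ = l := h1.eq_of_length_le (by omega)
  rw [h5, hl, mul_right_inj] at hm2
  have h6 := b.length_wordProd_le m₂
  rw [IsReducedWord, h5, wordProd_append, hl, hm2, List.length_append, hl'] at hm3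
  rw [hm2] at h6
  have h7 := b.length_le_of_mul (u := d) (v := u)
  omega

lemma length_mul_ofIdx_of_mem_minCosetReps {J : Set b.support} {d : P.weylGroup}
    (hd : d ∈ b.minCosetReps J) {i : b.support} (hi : i ∈ J) :
    b.length (d * weylGroup.ofIdx P i) = b.length d + 1 := by
  have h := hd _ (Subgroup.subset_closure ⟨i, hi, rfl⟩)
  change b.length d ≤ b.length (d * weylGroup.ofIdx P i) at h
  have := b.length_mul_ofIdx d i
  omega

/-- Write `w` as a minimal representative times an element of `W_J`; the last letter of a reduced
word of the latter works. -/
lemma exists_length_mul_ofIdx_of_notMem_minCosetReps [P.IsRootSystem] {J : Set b.support}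
    {w : P.weylGroup} (hw : w ∉ b.minCosetReps J) :
    ∃ i ∈ J, b.length (w * weylGroup.ofIdx P i) + 1 = b.length w := by
  have := P.finite_weylGroup
  obtain ⟨u, hu⟩ := Finite.exists_min (fun u : b.parabolic J => b.length (w * u))
  have hd : w * u ∈ b.minCosetReps J := fun v hv => by
    rw [mul_assoc]
    exact hu ⟨u * v, mul_mem u.2 hv⟩
  obtain ⟨l, hlJ, hl, hl'⟩ := b.exists_isReducedWord_of_mem_parabolic (inv_mem u.2)
  have hw1 := b.length_mul_of_mem_minCosetReps hd (inv_mem u.2)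
  rw [mul_inv_cancel_right, ← hl, hl'] at hw1
  obtain rfl | ⟨k, i, rfl⟩ := l.eq_nil_or_concat
  · rw [wordProd_nil, eq_comm, inv_eq_one] at hl
    rw [hl, mul_one] at hd
    exact absurd hd hw
  · refine ⟨i, hlJ i (by simp), ?_⟩
    have h1 : w * weylGroup.ofIdx P i = w * u * b.wordProd k := by
      have h2 : b.wordProd k * weylGroup.ofIdx P i = (u : P.weylGroup)⁻¹ := by
        rw [← hl, List.concat_eq_append, wordProd_append, wordProd_cons, wordProd_nil, mul_one]
      have h3 : b.wordProd k = (u : P.weylGroup)⁻¹ * weylGroup.ofIdx P i := by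
        rw [← h2, mul_assoc, ofIdx_mul_self, mul_one]
      rw [h3, mul_assoc, mul_inv_cancel_left]
    have h2 := b.length_le_of_mul (u := w * u) (v := b.wordProd k)
    have h3 := b.length_wordProd_le k
    have h4 := b.length_mul_ofIdx w i
    rw [← h1] at h2
    rw [List.concat_eq_append, List.length_append, List.length_singleton] at hw1
    omega

section Longest

variable [P.IsRootSystem]

lemma longestRep_mem (J : Set b.support) : b.longestRep J ∈ b.minCosetReps J :=
  (b.exists_longestRep J).choose_spec.1

lemma longestRep_inv_mul_mem (J : Set b.support) :
    (b.longestRep J)⁻¹ * b.longestElement ∈ b.parabolic J := by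
  obtain ⟨u, hu, h⟩ := (b.exists_longestRep J).choose_spec.2
  have h' : b.longestElement = b.longestRep J * u := h
  rwa [h', inv_mul_cancel_left]

/-- Two inequalities: `d_J⁻¹ w₀` is at most as long as `w_J`, and `d_J` is at most as long as `w₀
w_J`, which lies in the same coset. -/
lemma length_longestRep (J : Set b.support) :
    b.length (b.longestRep J) + b.length (b.longestParabolic J) = b.length b.longestElement := by
  obtain ⟨h1, h2⟩ := (b.exists_longest J).choose_spec
  change b.longestParabolic J ∈ _ at h1
  have h3 := h2 _ (b.longestRep_inv_mul_mem J)
  change _ ≤ b.length (b.longestParabolic J) at h3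
  have h4 := b.longestRep_mem J _ (mul_mem (b.longestRep_inv_mul_mem J) h1)
  rw [← mul_assoc, mul_inv_cancel_left] at h4
  have h5 := b.length_longestElement_mul (b.longestParabolic J)
  have h6 := b.length_inv_mul_longestElement (b.longestRep J)
  omega

/-! ### The dual basis of the elements `X_w` -/

/-- The operator `Δ_w` on the coinvariant algebra. -/
def coinvariantOp (w : P.weylGroup) : P.CoinvariantAlgebra →ₗ[ℂ] P.CoinvariantAlgebra :=
  P.coinvariantMap (b.demazureOp w) fun f hf => by
    obtain ⟨l, -, -, hl⟩ := b.demazureOp_eq_demazureWord w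
    rw [hl]
    clear hl
    induction l with
    | nil => exact hf
    | cons i l ih =>
      rw [demazureWord_cons]
      exact P.demazure_mem_coinvariantIdeal i ih

lemma coinvariantOp_toCoinvariant (w : P.weylGroup) (f : SymmetricAlgebra ℂ M) :
    b.coinvariantOp w (P.toCoinvariant f) = P.toCoinvariant (b.demazureOp w f) := rfl

lemma coinvariantOp_mul {v w : P.weylGroup} (h : b.length (v * w) = b.length v + b.length w)
    (x : P.CoinvariantAlgebra) :
    b.coinvariantOp (v * w) x = b.coinvariantOp v (b.coinvariantOp w x) := by
  obtain ⟨f, rfl⟩ := P.exists_toCoinvariant x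
  simp only [coinvariantOp_toCoinvariant, b.demazureOp_mul h]

lemma coinvariantOp_ofIdx (i : b.support) (x : P.CoinvariantAlgebra) :
    b.coinvariantOp (weylGroup.ofIdx P i) x = P.coinvariantDemazure i x := by
  obtain ⟨f, rfl⟩ := P.exists_toCoinvariant x
  rw [coinvariantOp_toCoinvariant, demazureOp_ofIdx, coinvariantDemazure_toCoinvariant]

/-- The linear form on the coinvariant algebra which maps an element to the constant term of its
image under `Δ_w`. -/
def coefficient (w : P.weylGroup) : P.CoinvariantAlgebra →ₗ[ℂ] ℂ :=
  P.coinvariantConstantTerm.toLinearMap ∘ₗ b.coinvariantOp w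

lemma coefficient_apply (w : P.weylGroup) (x : P.CoinvariantAlgebra) :
    b.coefficient w x = P.coinvariantConstantTerm (b.coinvariantOp w x) := rfl

lemma coefficient_toCoinvariant (w : P.weylGroup) (f : SymmetricAlgebra ℂ M) :
    b.coefficient w (P.toCoinvariant f) = constantTerm M (b.demazureOp w f) := rfl

lemma eq_zero_of_forall_coefficient {x : P.CoinvariantAlgebra}
    (h : ∀ w, b.coefficient w x = 0) : x = 0 := by
  obtain ⟨f, rfl⟩ := P.exists_toCoinvariant x
  exact P.toCoinvariant_eq_zero_iff.mpr (b.mem_coinvariantIdeal_of_forall_demazureOp h)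

lemma coefficient_schubertClass_self (w : P.weylGroup) :
    b.coefficient w (b.schubertClass w) = b.topConstant := by
  rw [schubertClass, coefficient_toCoinvariant, ← demazureOp_mul, mul_inv_cancel_left, topConstant]
  rw [mul_inv_cancel_left, add_comm, length_inv_mul_longestElement]

/-- Either the composite operator vanishes or it is `Δ_{v w⁻¹ w₀}`, whose length is below the degree
of `D` unless `v = w`. -/
lemma coefficient_schubertClass_of_ne {v w : P.weylGroup} (h : v ≠ w) :
    b.coefficient v (b.schubertClass w) = 0 := by
  rw [schubertClass, coefficient_toCoinvariant]
  by_cases hlen : b.length (v * (w⁻¹ * b.longestElement)) =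
      b.length v + b.length (w⁻¹ * b.longestElement)
  · rw [← b.demazureOp_mul hlen]
    refine b.constantTerm_demazureOp_eq_zero _ b.topElement_mem_symPower fun heq => h ?_
    have h1 := b.eq_longestElement_of_length_eq heq.symm
    rw [← mul_assoc, mul_eq_right, mul_inv_eq_one] at h1
    exact h1
  · rw [b.demazureOp_demazureOp_of_ne hlen, map_zero]

lemma eq_sum_coefficient_smul_schubertClass [Fintype P.weylGroup] (x : P.CoinvariantAlgebra) :
    x = ∑ w : P.weylGroup, (b.topConstant⁻¹ * b.coefficient w x) • b.schubertClass w := by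
  rw [← sub_eq_zero]
  refine b.eq_zero_of_forall_coefficient fun v => ?_
  rw [map_sub, map_sum, Finset.sum_eq_single v]
  · rw [map_smul, coefficient_schubertClass_self, smul_eq_mul, mul_right_comm,
      inv_mul_cancel₀ b.topConstant_ne_zero, one_mul, sub_self]
  · intro w _ hw
    rw [map_smul, coefficient_schubertClass_of_ne b hw.symm, smul_zero]
  · exact fun h => absurd (Finset.mem_univ v) h

/-! ### The invariants of a parabolic subgroup -/

/-- For `i ∈ J`, `d s_i` is longer than `d`, so `d⁻¹ w₀` has a reduced word starting with `i`; the
image of `Δ_i` is `s_i`-invariant. -/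
lemma coinvariantOp_mem_parabolicInvariants {J : Set b.support} {d : P.weylGroup}
    (hd : d ∈ b.minCosetReps J) (x : P.CoinvariantAlgebra) :
    b.coinvariantOp (d⁻¹ * b.longestElement) x ∈ b.parabolicInvariants J := by
  rw [mem_parabolicInvariants_iff]
  intro i hi
  have h1 := b.length_mul_ofIdx_of_mem_minCosetReps hd hi
  have h2 := b.length_inv_mul_longestElement d
  have h3 := b.length_inv_mul_longestElement (d * weylGroup.ofIdx P i)
  rw [mul_inv_rev, ofIdx_inv, mul_assoc] at h3
  have h4 : d⁻¹ * b.longestElement =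
      weylGroup.ofIdx P i * (weylGroup.ofIdx P i * (d⁻¹ * b.longestElement)) := by
    rw [← mul_assoc, ofIdx_mul_self, one_mul]
  rw [h4, coinvariantOp_mul, coinvariantOp_ofIdx, weylCoinvariant_coinvariantDemazure]
  rw [← h4, length_ofIdx]
  omega

lemma schubertClass_mem_parabolicInvariants {J : Set b.support} {d : P.weylGroup}
    (hd : d ∈ b.minCosetReps J) : b.schubertClass d ∈ b.parabolicInvariants J :=
  b.coinvariantOp_mem_parabolicInvariants hd (P.toCoinvariant b.topElement)

lemma coefficient_eq_zero_of_notMem_minCosetReps {J : Set b.support} {w : P.weylGroup}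
    (hw : w ∉ b.minCosetReps J) {x : P.CoinvariantAlgebra} (hx : x ∈ b.parabolicInvariants J) :
    b.coefficient w x = 0 := by
  obtain ⟨i, hi, h⟩ := b.exists_length_mul_ofIdx_of_notMem_minCosetReps hw
  have h1 : w = w * weylGroup.ofIdx P i * weylGroup.ofIdx P i := by
    rw [mul_assoc, ofIdx_mul_self, mul_one]
  rw [coefficient_apply, h1, coinvariantOp_mul, coinvariantOp_ofIdx,
    P.coinvariantDemazure_of_invariant (b.mem_parabolicInvariants_iff.mp hx i hi), map_zero,
    map_zero]
  rw [← h1, length_ofIdx, h]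

lemma coinvariantOp_mul_of_mem_parabolic {J : Set b.support} {u : P.weylGroup}
    (hu : u ∈ b.parabolic J) {x : P.CoinvariantAlgebra} (hx : x ∈ b.parabolicInvariants J)
    (y : P.CoinvariantAlgebra) : b.coinvariantOp u (x * y) = x * b.coinvariantOp u y := by
  obtain ⟨l, hlJ, rfl, hl⟩ := b.exists_isReducedWord_of_mem_parabolic hu
  obtain ⟨f, rfl⟩ := P.exists_toCoinvariant x
  obtain ⟨g, rfl⟩ := P.exists_toCoinvariant y
  rw [← map_mul, coinvariantOp_toCoinvariant, coinvariantOp_toCoinvariant,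
    ← b.demazureWord_of_isReducedWord hl]
  clear hl hu
  induction l with
  | nil => exact map_mul _ _ _
  | cons i l ih =>
    have hi := b.mem_parabolicInvariants_iff.mp hx i (hlJ i List.mem_cons_self)
    rw [demazureWord_cons, demazureWord_cons, ← coinvariantDemazure_toCoinvariant,
      ih fun j hj => hlJ j (List.mem_cons_of_mem _ hj), coinvariantDemazure_mul,
      P.coinvariantDemazure_of_invariant hi, zero_mul, zero_add, hi,
      coinvariantDemazure_toCoinvariant]

/-! ### Duality -/

/-- Self-adjointness of each `Δ_i`: `Δ_{w₀}` factors through `Δ_i`, and `Δ_i` sends both `Δ_i f * g`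
and `f * Δ_i g` to `Δ_i f * Δ_i g`. -/
lemma demazureOp_longestElement_demazureWord_mul (l : List b.support)
    (f g : SymmetricAlgebra ℂ M) :
    b.demazureOp b.longestElement (b.demazureWord l f * g) =
      b.demazureOp b.longestElement (f * b.demazureWord l.reverse g) := by
  have hstep (i : b.support) (f g : SymmetricAlgebra ℂ M) :
      b.demazureOp b.longestElement (P.demazure i f * g) =
        b.demazureOp b.longestElement (f * P.demazure i g) := by
    have h1 := b.length_mul_ofIdx_lt
      (b.not_isPos_longestElement_smul (b.isPos_of_mem_support i.2))
    have h2 : b.longestElement = b.longestElement * weylGroup.ofIdx P i * weylGroup.ofIdx P i := by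
      rw [mul_assoc, ofIdx_mul_self, mul_one]
    have h3 (h : SymmetricAlgebra ℂ M) : b.demazureOp b.longestElement h =
        b.demazureOp (b.longestElement * weylGroup.ofIdx P i) (P.demazure i h) := by
      conv_lhs => rw [h2]
      rw [b.demazureOp_mul (by rw [← h2, length_ofIdx, h1]), demazureOp_ofIdx]
    rw [h3, h3 (f * _), demazure_mul, demazure_mul, demazure_demazure, demazure_demazure,
      weylSym_demazure, zero_mul, zero_add, mul_zero, add_zero]
  induction l generalizing g with
  | nil => rfl
  | cons i l ih =>
    rw [demazureWord_cons, hstep, ih, List.reverse_cons, demazureWord_append, demazureWord_cons,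
      demazureWord_nil]

lemma constantTerm_demazureOp_longestElement_mul_topElement (f : SymmetricAlgebra ℂ M) :
    constantTerm M (b.demazureOp b.longestElement (f * b.topElement)) =
      constantTerm M f * b.topConstant := by
  obtain ⟨s, g, hg, rfl⟩ := exists_sum_symPower f
  rw [Finset.sum_mul, map_sum, map_sum, map_sum, Finset.sum_mul]
  refine Finset.sum_congr rfl fun j _ => ?_
  by_cases hj : j = 0
  · subst hj
    rw [mem_symPower_zero (hg 0), ← Algebra.smul_def, map_smul, map_smul, smul_eq_mul,
      AlgHom.commutes]
    rfl
  · rw [constantTerm_eq_zero hj (hg j), zero_mul]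
    exact b.constantTerm_demazureOp_eq_zero _
      (mul_mem_symPower (hg j) b.topElement_mem_symPower) (by omega)

/-- The pairing `(x, y) ↦ Δ_{w₀} (x y)` on the coinvariant algebra is nondegenerate. -/
lemma exists_coefficient_longestElement_mul_ne_zero {x : P.CoinvariantAlgebra} (hx : x ≠ 0) :
    ∃ y, b.coefficient b.longestElement (x * y) ≠ 0 := by
  obtain ⟨w, hw⟩ : ∃ w, b.coefficient w x ≠ 0 := by
    by_contra! h
    exact hx (b.eq_zero_of_forall_coefficient h)
  obtain ⟨f, rfl⟩ := P.exists_toCoinvariant x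
  obtain ⟨l, -, -, hl⟩ := b.demazureOp_eq_demazureWord w
  -- Adjointness moves the reversed word back onto `f`; pairing with `D` then reads off the constant
  -- term of `Δ_w f`.
  refine ⟨P.toCoinvariant (b.demazureWord l.reverse b.topElement), ?_⟩
  rw [← map_mul, coefficient_toCoinvariant, ← demazureOp_longestElement_demazureWord_mul,
    constantTerm_demazureOp_longestElement_mul_topElement, ← hl]
  exact mul_ne_zero hw b.topConstant_ne_zero

/-! ### The symmetrizing form -/

/-- The linear form on `C^J` with `X_d ↦ 1` for the longest minimal coset representative `d`, and
`X_d ↦ 0` for the others. -/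
def parabolicTrace (J : Set b.support) : b.parabolicInvariants J →ₗ[ℂ] ℂ :=
  b.topConstant⁻¹ • (b.coefficient (b.longestRep J) ∘ₗ (b.parabolicInvariants J).val.toLinearMap)

lemma parabolicTrace_apply (J : Set b.support) (x : b.parabolicInvariants J) :
    b.parabolicTrace J x = b.topConstant⁻¹ * b.coefficient (b.longestRep J) x := rfl

open Classical in
lemma parabolicTrace_schubertClass {J : Set b.support} {d : P.weylGroup}
    (h : b.schubertClass d ∈ b.parabolicInvariants J) :
    b.parabolicTrace J ⟨b.schubertClass d, h⟩ = if d = b.longestRep J then 1 else 0 := by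
  rw [parabolicTrace_apply]
  split_ifs with hd
  · rw [← hd, coefficient_schubertClass_self, inv_mul_cancel₀ b.topConstant_ne_zero]
  · rw [coefficient_schubertClass_of_ne b (Ne.symm hd), mul_zero]

/-- The `X_d` with `d ∈ W^J` span `C^J`: the other terms in the expansion of an invariant have zero
coefficient. -/
lemma linearMap_ext_schubertClass {J : Set b.support} {τ τ' : b.parabolicInvariants J →ₗ[ℂ] ℂ}
    (h : ∀ d (hd : d ∈ b.minCosetReps J),
      τ ⟨b.schubertClass d, b.schubertClass_mem_parabolicInvariants hd⟩ =
        τ' ⟨b.schubertClass d, b.schubertClass_mem_parabolicInvariants hd⟩) : τ = τ' := by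
  classical
  have := P.finite_weylGroup
  have := Fintype.ofFinite P.weylGroup
  ext x
  have hx : x = ∑ w : P.weylGroup, (b.topConstant⁻¹ * b.coefficient w x) •
      if hw : w ∈ b.minCosetReps J then
        (⟨b.schubertClass w, b.schubertClass_mem_parabolicInvariants hw⟩ :
          b.parabolicInvariants J) else 0 := by
    apply Subtype.ext
    rw [AddSubmonoidClass.coe_finsetSum]
    conv_lhs => rw [b.eq_sum_coefficient_smul_schubertClass (x : P.CoinvariantAlgebra)]
    refine Finset.sum_congr rfl fun w _ => ?_
    split_ifs with hw
    · rfl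
    · rw [b.coefficient_eq_zero_of_notMem_minCosetReps hw x.2, mul_zero, zero_smul, smul_zero]
      rfl
  rw [hx, map_sum, map_sum]
  refine Finset.sum_congr rfl fun w _ => ?_
  rw [map_smul, map_smul]
  split_ifs with hw
  · rw [h w hw]
  · rw [map_zero, map_zero]

lemma isSymmetrizingForm_parabolicTrace (J : Set b.support) :
    IsSymmetrizingForm (b.parabolicTrace J) := by
  refine ⟨fun x y => by rw [mul_comm], fun x hx => ?_⟩
  obtain ⟨z, hz⟩ := b.exists_coefficient_longestElement_mul_ne_zero
    (x := (x : P.CoinvariantAlgebra)) (fun h => hx (Subtype.ext h))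
  -- The witness is `Δ_u z` with `u = d_J⁻¹ w₀`; as `u ∈ W_J`, `x` passes through `Δ_u`, and
  -- `Δ_{d_J} Δ_u = Δ_{w₀}`.
  refine ⟨⟨_, b.coinvariantOp_mem_parabolicInvariants (b.longestRep_mem J) z⟩, ?_⟩
  rw [parabolicTrace_apply]
  refine mul_ne_zero (inv_ne_zero b.topConstant_ne_zero) ?_
  change b.coefficient (b.longestRep J) ((x : P.CoinvariantAlgebra) * _) ≠ 0
  rw [← b.coinvariantOp_mul_of_mem_parabolic (b.longestRep_inv_mul_mem J) x.2, coefficient_apply,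
    ← coinvariantOp_mul, mul_inv_cancel_left]
  · exact hz
  · rw [mul_inv_cancel_left, add_comm, length_inv_mul_longestElement]

lemma isHomogeneousForm_parabolicTrace (J : Set b.support) :
    IsHomogeneousForm (b.parabolicDegree J)
      (-2 * (b.length b.longestElement : ℤ) + 2 * (b.length (b.longestParabolic J) : ℤ))
      (b.parabolicTrace J) := by
  intro k hk x hx
  have hle : P.coinvariantDegree k ≤ LinearMap.ker (b.coefficient (b.longestRep J)) := by
    refine iSup₂_le fun j hj => ?_
    rw [Submodule.map_le_iff_le_comap]
    intro f hf
    refine b.constantTerm_demazureOp_eq_zero (b.longestRep J) hf fun h => hk ?_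
    have := b.length_longestRep J
    omega
  have h0 : b.coefficient (b.longestRep J) x = 0 := hle hx
  rw [parabolicTrace_apply, h0, mul_zero]

end Longest

end Finite

end Base

end RootPairing

end

/-! ### The main theorem. -/

open Classical in
theorem mainTheorem4 {ι M N : Type*} [Finite ι] [AddCommGroup M] [Module ℂ M]
    [AddCommGroup N] [Module ℂ N] (P : RootPairing ι ℂ M N) [P.IsRootSystem]
    [P.IsCrystallographic] [P.IsReduced] (b : P.Base) (J : Set b.support) :
    ∃ hX : ∀ d ∈ b.minCosetReps J, b.schubertClass d ∈ b.parabolicInvariants J,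
    ∃ tr : b.parabolicInvariants J →ₗ[ℂ] ℂ,
      (∀ d (hd : d ∈ b.minCosetReps J),
        tr ⟨b.schubertClass d, hX d hd⟩ = if d = b.longestRep J then 1 else 0) ∧
      (∀ tr' : b.parabolicInvariants J →ₗ[ℂ] ℂ,
        (∀ d (hd : d ∈ b.minCosetReps J),
          tr' ⟨b.schubertClass d, hX d hd⟩ = if d = b.longestRep J then 1 else 0) → tr' = tr) ∧
      IsSymmetrizingForm tr ∧
      IsHomogeneousForm (b.parabolicDegree J)
        (-2 * (b.length b.longestElement : ℤ) + 2 * (b.length (b.longestParabolic J) : ℤ)) tr := by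
  refine ⟨fun d hd => b.schubertClass_mem_parabolicInvariants hd, b.parabolicTrace J,
    fun d hd => b.parabolicTrace_schubertClass _, fun tr' h => ?_,
    b.isSymmetrizingForm_parabolicTrace J, b.isHomogeneousForm_parabolicTrace J⟩
  exact b.linearMap_ext_schubertClass fun d hd =>
    (h d hd).trans (b.parabolicTrace_schubertClass _).symm
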